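/- **Theorem (System identification).** There is an absolute constant $C>0$ for which the following holds. *Setting.* Consider $m\ge 1$ agents with identical dynamics $x_{i,t+1}=Ax_{i,t}+Bu_{i,t}+w_t$, $x_{i,1}=0$ ($i\in[m]$, $t\ge 1$), where $A\in\mathbb R^{d_1\times d_1}$, $B\in\mathbb R^{d_1\times d_2}$, $d_1,d_2\ge 1$. Norms are Euclidean (vectors) and spectral (matrices). Let $\kappa,W\ge 1$, $\delta\in(0,1)$, and assume: 1. $\|A\|,\|B\|\le\kappa$, and $(w_t)$ is an arbitrary sequence, fixed in advance, with $\|w_t\|\le W$. 2. All agents know a matrix $K$ that is $(\kappa,\gamma)$-strongly stable for $(A,B)$: $0<\gamma\le1$, $\|K\|\le\kappa$, and $A-BK=HLH^{-1}$ with $\|L\|\le1-\gamma$ and $\|H\|,\|H^{-1}\|\le\kappa$. 3. $(A-BK,B)$ is $(q,\kappa)$-strongly controllable: $q\ge1$ and, for $C_q=[B,(A-BK)B,\dots,(A-BK)^{q-1}B]$, the matrix $C_qC_q^\top$ is invertible with $\|(C_qC_q^\top)^{-1}\|\le\kappa$. 4. $P\in\mathbb R^{m\times m}$ is symmetric and doubly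 stochastic with positive diagonal, and the graph of its positive off-diagonal entries is connected; $\beta$ denotes its second largest singular value ($\beta=0$ if $m=1$). *Algorithm.* For $t=1,\dots,T_{collect}$, where $T_{collect}>q+1$, agent $i$ applies $u_{i,t}=-Kx_{i,t}+\xi_{i,t}$, where the $\xi_{i,t}$ are i.i.d. (over all $i$ and $t$) uniform on $\{\pm1\}^{d_2}$. For $0\le l\le q$ it forms $$N^{T_{collect}}_{i,l}=\frac1{T_{collect}-(q+1)}\sum_{t=1}^{T_{collect}-(q+1)}x_{i,t+l+1}\,\xi_{i,t}^\top .$$ Then the agents average for $T_{exchange}$ rounds, $N^{t}_{i,l}=\sum_{j}P_{ji}N^{t-1}_{j,l}$ for $t=T_{collect}+1,\dots,T_0$, where $T_0=T_{collect}+T_{exchange}$. With $C_{i,0}=[N^{T_0}_{i,0},\dots,N^{T_0}_{i,q-1}]$ and $C_{i,1}=[N^{T_0}_{i,1},\dots,N^{T_0}_{i,q}]$, agent $i$ returns $$\widehat B_i=N^{T_0}_{i,0},\qquad \widehat A_i=C_{i,1}C_{i,0}^\top(C_{i,0}C_{i,0}^\top)^{-1}+\widehat B_iK .$$ *Claim.*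 Put $\Lambda=\log\big(d_1d_2(q+1)m/\delta\big)$ and $S=m\,(T_{collect}-(q+1))$. If $T_{collect}$ and $T_{exchange}$ are large enough that $$S\ \ge\ C\,\frac{q\,d_2^2\,\kappa^7W^2}{\gamma^2}\,\Lambda\qquad\text{and}\qquad \sqrt m\,\beta^{T_{exchange}}\le\sqrt{\frac{2\Lambda}{S}},$$ then with probability at least $1-\delta$, simultaneously for all $i\in[m]$, the matrix $C_{i,0}C_{i,0}^\top$ is invertible (so the estimates are well defined) and $$\|\widehat A_i-A\|\le\epsilon_{A,B},\quad \|\widehat B_i-B\|\le\epsilon_{A,B},\qquad \epsilon_{A,B}=C\,\frac{d_2W\sqrt{d_1q}\,\kappa^{11/2}}{\gamma}\sqrt{\frac{\log\big(d_1d_2(q+1)m/\delta\big)}{m\,(T_{collect}-(q+1))}} .$$ -/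

import Mathlib

open MeasureTheory ProbabilityTheory
open scoped Matrix Matrix.Norms.L2Operator

/-! Throughout, `‖·‖` of a matrix is the spectral norm (the scoped instances of
`Matrix.Norms.L2Operator`); vectors are plain functions `Fin d → ℝ`, and the Euclidean norm of
`v` is written `‖WithLp.toLp 2 v‖`. -/

noncomputable section

namespace DistributedSysId

/-- The policy `u = -K x` is `(κ, γ)`-strongly stable for the system `(A, B)`. -/
def StronglyStable {d₁ d₂ : ℕ} (A : Matrix (Fin d₁) (Fin d₁) ℝ) (B : Matrix (Fin d₁) (Fin d₂) ℝ)
    (K : Matrix (Fin d₂) (Fin d₁) ℝ) (κ γ : ℝ) : Prop :=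
  0 < κ ∧ 0 < γ ∧ γ ≤ 1 ∧ ‖K‖ ≤ κ ∧
    ∃ L H : Matrix (Fin d₁) (Fin d₁) ℝ, IsUnit H ∧ A - B * K = H * L * H⁻¹ ∧
      ‖L‖ ≤ 1 - γ ∧ ‖H‖ ≤ κ ∧ ‖H⁻¹‖ ≤ κ

/-- The block row `[N 0, N 1, …, N (q-1)]` of `d₁ × d₂` matrices, a `d₁ × (q d₂)` matrix. -/
def blockRow {d₁ d₂ : ℕ} (q : ℕ) (N : ℕ → Matrix (Fin d₁) (Fin d₂) ℝ) :
    Matrix (Fin d₁) (Fin q × Fin d₂) ℝ :=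
  Matrix.of fun a p => N (p.1 : ℕ) a p.2

/-- `C_q = [B, A B, …, A^(q-1) B]`. -/
def controllabilityMatrix {d₁ d₂ : ℕ} (A : Matrix (Fin d₁) (Fin d₁) ℝ)
    (B : Matrix (Fin d₁) (Fin d₂) ℝ) (q : ℕ) : Matrix (Fin d₁) (Fin q × Fin d₂) ℝ :=
  blockRow q fun l => A ^ l * B

/-- `(A, B)` is `(q, κ)`-strongly controllable. -/
def StronglyControllable {d₁ d₂ : ℕ} (A : Matrix (Fin d₁) (Fin d₁) ℝ)
    (B : Matrix (Fin d₁) (Fin d₂) ℝ) (q : ℕ) (κ : ℝ) : Prop :=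
  1 ≤ q ∧ IsUnit (controllabilityMatrix A B q * (controllabilityMatrix A B q)ᵀ) ∧
    ‖(controllabilityMatrix A B q * (controllabilityMatrix A B q)ᵀ)⁻¹‖ ≤ κ

/-- The weight matrix of the communication network: symmetric, doubly stochastic, with positive
diagonal, and with connected graph of positive off-diagonal weights. -/
structure IsNetworkMatrix {m : ℕ} (P : Matrix (Fin m) (Fin m) ℝ) : Prop where
  symm : P.IsSymm
  doublyStochastic : P ∈ doublyStochastic ℝ (Fin m)
  diag_pos : ∀ i, 0 < P i i
  connected : (SimpleGraph.fromRel fun i j => 0 < P i j).Connected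

/-- The second largest singular value of `P` (singular values are indexed from `0`, in
nonincreasing order, with multiplicity; the value is `0` for a `1 × 1` matrix). -/
def secondSingularValue {m : ℕ} (P : Matrix (Fin m) (Fin m) ℝ) : ℝ :=
  (Matrix.toEuclideanLin P).singularValues 1

/-- The sign vectors `{±1}^d`. -/
def signCube (d : ℕ) : Set (Fin d → ℝ) := {v | ∀ a, v a = 1 ∨ v a = -1}

/-- The exploration signals `ξ i t` of agents `i` at times `t` are i.i.d. uniform on `{±1}^d`,
independent over all pairs `(i, t)`. -/
structure IsExplorationNoise {m d : ℕ} {Ω : Type*} [MeasurableSpace Ω] (μ : Measure Ω)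
    (ξ : Fin m → ℕ → Ω → (Fin d → ℝ)) : Prop where
  measurable : ∀ i t, Measurable (ξ i t)
  law : ∀ i t, μ.map (ξ i t) = uniformOn (signCube d)
  indep : iIndepFun (fun p : Fin m × ℕ => ξ p.1 p.2) μ

/-- The exploration control `u = -K x + ξ`. -/
def explorationControl {d₁ d₂ : ℕ} (K : Matrix (Fin d₂) (Fin d₁) ℝ) (x : Fin d₁ → ℝ)
    (ξ : Fin d₂ → ℝ) : Fin d₂ → ℝ :=
  -(K *ᵥ x) + ξ

/-- The state of one agent: `x₁ = 0` and `x_{t+1} = A x_t + B u_t + w_t` for `t ≥ 1`, under the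
exploration control. Time starts at `1`; the value at time `0` is a dummy. -/
def explorationState {d₁ d₂ : ℕ} (A : Matrix (Fin d₁) (Fin d₁) ℝ)
    (B : Matrix (Fin d₁) (Fin d₂) ℝ) (K : Matrix (Fin d₂) (Fin d₁) ℝ)
    (w : ℕ → Fin d₁ → ℝ) (ξ : ℕ → Fin d₂ → ℝ) : ℕ → Fin d₁ → ℝ
  | 0 => 0
  | 1 => 0
  | t + 2 =>
      A *ᵥ explorationState A B K w ξ (t + 1) +
        B *ᵥ explorationControl K (explorationState A B K w ξ (t + 1)) (ξ (t + 1)) + w (t + 1)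

/-- The moment `N_l = 1 / (T_c - (q+1)) ∑_{t=1}^{T_c-(q+1)} x_{t+l+1} ξ_tᵀ` of one agent's data
(`0 ≤ l ≤ q`). -/
def localMoment {d₁ d₂ : ℕ} (q Tc : ℕ) (x : ℕ → Fin d₁ → ℝ) (ξ : ℕ → Fin d₂ → ℝ) (l : ℕ) :
    Matrix (Fin d₁) (Fin d₂) ℝ :=
  (1 / ((Tc : ℝ) - ((q : ℝ) + 1))) •
    ∑ t ∈ Finset.Icc 1 (Tc - (q + 1)), Matrix.vecMulVec (x (t + l + 1)) (ξ t)

/-- `s` rounds of consensus averaging `N_i ← ∑_j P_{ji} N_j`. -/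
def exchange {m d₁ d₂ : ℕ} (P : Matrix (Fin m) (Fin m) ℝ)
    (N : Fin m → Matrix (Fin d₁) (Fin d₂) ℝ) : ℕ → Fin m → Matrix (Fin d₁) (Fin d₂) ℝ
  | 0 => N
  | s + 1 => fun i => ∑ j, P j i • exchange P N s j

/-- Agent `i`'s moments `l ↦ N_{i,l}` after `Tc` exploration steps and `Te` exchange rounds. -/
def finalMoment {m d₁ d₂ : ℕ} (A : Matrix (Fin d₁) (Fin d₁) ℝ) (B : Matrix (Fin d₁) (Fin d₂) ℝ)
    (K : Matrix (Fin d₂) (Fin d₁) ℝ) (P : Matrix (Fin m) (Fin m) ℝ) (q Tc Te : ℕ)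
    (w : ℕ → Fin d₁ → ℝ) (ξ : Fin m → ℕ → Fin d₂ → ℝ) (i : Fin m) (l : ℕ) :
    Matrix (Fin d₁) (Fin d₂) ℝ :=
  exchange P (fun j => localMoment q Tc (explorationState A B K w (ξ j)) (ξ j) l) Te i

/-- `C₀ = [N_0, …, N_{q-1}]`. -/
def regressor {d₁ d₂ : ℕ} (q : ℕ) (N : ℕ → Matrix (Fin d₁) (Fin d₂) ℝ) :
    Matrix (Fin d₁) (Fin q × Fin d₂) ℝ :=
  blockRow q N

/-- `C₁ = [N_1, …, N_q]`. -/
def response {d₁ d₂ : ℕ} (q : ℕ) (N : ℕ → Matrix (Fin d₁) (Fin d₂) ℝ) :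
    Matrix (Fin d₁) (Fin q × Fin d₂) ℝ :=
  blockRow q fun l => N (l + 1)

/-- `B̂ = N_0`. -/
def estimateB {d₁ d₂ : ℕ} (N : ℕ → Matrix (Fin d₁) (Fin d₂) ℝ) : Matrix (Fin d₁) (Fin d₂) ℝ :=
  N 0

/-- `Â = C₁ C₀ᵀ (C₀ C₀ᵀ)⁻¹ + B̂ K`. -/
def estimateA {d₁ d₂ : ℕ} (q : ℕ) (K : Matrix (Fin d₂) (Fin d₁) ℝ)
    (N : ℕ → Matrix (Fin d₁) (Fin d₂) ℝ) : Matrix (Fin d₁) (Fin d₁) ℝ :=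
  response q N * (regressor q N)ᵀ * (regressor q N * (regressor q N)ᵀ)⁻¹ + estimateB N * K

/-- The logarithmic factor `log (d₁ d₂ (q+1) m / δ)`. -/
def logFactor (m d₁ d₂ q : ℕ) (δ : ℝ) : ℝ :=
  Real.log ((d₁ : ℝ) * d₂ * ((q : ℝ) + 1) * m / δ)

/-- The number `m (T_c - (q+1))` of samples used by all agents together. -/
def sampleSize (m q Tc : ℕ) : ℝ := (m : ℝ) * ((Tc : ℝ) - ((q : ℝ) + 1))

/-- The rate `(d₂ W √(d₁ q) κ^(11/2) / γ) √(log (d₁ d₂ (q+1) m / δ) / (m (T_c - (q+1))))`. -/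
def estimationRate (m d₁ d₂ q Tc : ℕ) (κ γ W δ : ℝ) : ℝ :=
  (d₂ : ℝ) * W * Real.sqrt ((d₁ : ℝ) * q) * κ ^ (11 / 2 : ℝ) / γ *
    Real.sqrt (logFactor m d₁ d₂ q δ / sampleSize m q Tc)

end DistributedSysId

end

/-!
Unrolling the closed loop gives `x_{t+1} = ∑ₛ (A - B K)^(t-s) (B ξ_s + w_s)`. The signals are
independent, centered and of identity covariance, so `x_{t+l+1} ξ_tᵀ` has the mean
`(A - B K)^l B`: the moments estimate the blocks of the controllability matrix, and `A - B K` is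
recovered as the least-squares solution that maps the first `q` blocks to the last `q`.

The average of the moments over all agents is a function of independent bounded signals. Since
strong stability makes the influence of one signal on later states decay geometrically, changing
one signal moves the average by at most a multiple of `1 / S`, for `S` samples in total. McDiarmid's
inequality in the Hilbert space of matrices with the Frobenius norm therefore gives deviations of
order `√(Λ / S)`, where `Λ` is the logarithmic factor. Each consensus round contracts the
disagreement between the agents by the second singular value of `P`. Finally, the Gram matrix of
the estimated blocks stays invertible as long as their error is of order `κ^(-1/2)`, which is where
the sample-size condition enters.
-/

namespace DistributedSysId

section BoundedDifferences

/-- McDiarmid's condition: changing the `i`-th argument of `F` moves its value by at most `c i`. -/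
def HasBoundedDifferences {ι : Type*} [DecidableEq ι] {α : ι → Type*} {E : Type*}
    [NormedAddCommGroup E] (F : (∀ i, α i) → E) (c : ι → ℝ) : Prop :=
  ∀ i x a, ‖F (Function.update x i a) - F x‖ ≤ c i

namespace HasBoundedDifferences

variable {ι : Type*} [DecidableEq ι] {α : ι → Type*} {E : Type*} [NormedAddCommGroup E]
  {F : (∀ i, α i) → E} {c : ι → ℝ}

theorem const_smul [NormedSpace ℝ E] (h : HasBoundedDifferences F c) {r : ℝ} (hr : 0 ≤ r) :
    HasBoundedDifferences (fun x => r • F x) fun i => r * c i := by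
  intro i x a
  rw [← smul_sub, norm_smul, Real.norm_of_nonneg hr]
  exact mul_le_mul_of_nonneg_left (h i x a) hr

theorem norm_sub_le [Fintype ι] (h : HasBoundedDifferences F c) (x y : ∀ i, α i) :
    ‖F x - F y‖ ≤ ∑ i, c i := by
  have hs : ∀ s : Finset ι, ‖F (s.piecewise x y) - F y‖ ≤ ∑ i ∈ s, c i := by
    intro s
    induction s using Finset.induction_on with
    | empty => simp
    | insert i s hi ih =>
      rw [Finset.piecewise_insert, Finset.sum_insert hi]
      exact (norm_sub_le_norm_sub_add_norm_sub _ _ _).trans (add_le_add (h i _ _) ih)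
  simpa only [Finset.piecewise_univ] using hs Finset.univ

theorem norm_le [Fintype ι] (h : HasBoundedDifferences F c) (y x : ∀ i, α i) :
    ‖F x‖ ≤ ‖F y‖ + ∑ i, c i := by
  linarith [norm_sub_norm_le (F x) (F y), h.norm_sub_le x y]

theorem integrable [Finite ι] [∀ i, MeasurableSpace (α i)] (h : HasBoundedDifferences F c)
    (hF : StronglyMeasurable F) (μ : Measure (∀ i, α i)) [IsProbabilityMeasure μ] :
    Integrable F μ := by
  have := Fintype.ofFinite ι
  obtain ⟨y⟩ := μ.nonempty_of_neZero
  exact .of_bound hF.aestronglyMeasurable _ (.of_forall (h.norm_le y))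

end HasBoundedDifferences

end BoundedDifferences

section FinCons

variable {n : ℕ} {α : Fin (n + 1) → Type*} [∀ i, MeasurableSpace (α i)]
  (μ : ∀ i, Measure (α i)) [∀ i, IsProbabilityMeasure (μ i)]

theorem measurePreserving_finCons :
    MeasurePreserving (fun p : α 0 × (∀ i : Fin n, α i.succ) => (Fin.cons p.1 p.2 : ∀ i, α i))
      ((μ 0).prod (Measure.pi fun i => μ i.succ)) (Measure.pi μ) := by
  have hcons : (fun p : α 0 × (∀ i : Fin n, α i.succ) => (Fin.cons p.1 p.2 : ∀ i, α i)) =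
      (MeasurableEquiv.piFinSuccAbove α 0).symm :=
    funext fun p => funext (Fin.cases rfl fun _ => rfl)
  rw [hcons]
  exact (measurePreserving_piFinSuccAbove μ 0).symm _

variable {E : Type*} [NormedAddCommGroup E] {F : (∀ i, α i) → E} {c : Fin (n + 1) → ℝ}

theorem HasBoundedDifferences.integrable_cons (h : HasBoundedDifferences F c)
    (hF : StronglyMeasurable F) (y : ∀ i : Fin n, α i.succ) :
    Integrable (fun a => F (Fin.cons a y)) (μ 0) := by
  obtain ⟨a₀⟩ := (μ 0).nonempty_of_neZero
  have hmeas : StronglyMeasurable fun a => F (Fin.cons a y) :=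
    hF.comp_measurable ((measurePreserving_finCons μ).measurable.comp measurable_prodMk_right)
  exact .of_bound hmeas.aestronglyMeasurable _ (.of_forall fun a => h.norm_le (Fin.cons a₀ y) _)

variable [NormedSpace ℝ E]

theorem integral_pi_eq_integral_cons {f : (∀ i, α i) → E} (hf : Integrable f (Measure.pi μ)) :
    ∫ x, f x ∂Measure.pi μ =
      ∫ y, ∫ a, f (Fin.cons a y) ∂μ 0 ∂Measure.pi fun i => μ i.succ := by
  have hcons := measurePreserving_finCons μ
  rw [← hcons.map_eq, integral_map hcons.aemeasurable (hcons.map_eq ▸ hf.aestronglyMeasurable)]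
  exact integral_prod_symm _ (hcons.integrable_comp_of_integrable hf)

theorem stronglyMeasurable_integral_cons {F : (∀ i, α i) → E} (hF : StronglyMeasurable F) :
    StronglyMeasurable fun y => ∫ a, F (Fin.cons a y) ∂μ 0 :=
  (hF.comp_measurable (measurePreserving_finCons μ).measurable).integral_prod_left'

theorem HasBoundedDifferences.integral_cons (h : HasBoundedDifferences F c)
    (hF : StronglyMeasurable F) :
    HasBoundedDifferences (fun y => ∫ a, F (Fin.cons a y) ∂μ 0) fun i : Fin n => c i.succ := by
  intro i y b
  rw [← integral_sub (h.integrable_cons μ hF _) (h.integrable_cons μ hF _)]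
  refine (norm_integral_le_of_norm_le_const (C := c i.succ) (.of_forall fun a => ?_)).trans
    (by simp)
  rw [Fin.cons_update]
  exact h _ _ _

theorem HasBoundedDifferences.norm_cons_sub_integral_le [CompleteSpace E]
    (h : HasBoundedDifferences F c) (hF : StronglyMeasurable F) (a : α 0)
    (y : ∀ i : Fin n, α i.succ) :
    ‖F (Fin.cons a y) - ∫ b, F (Fin.cons b y) ∂μ 0‖ ≤ c 0 := by
  have hconst : ∫ _, F (Fin.cons a y) ∂μ 0 = F (Fin.cons a y) := by simp
  rw [← hconst, ← integral_sub (integrable_const _) (h.integrable_cons μ hF y)]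
  refine (norm_integral_le_of_norm_le_const (C := c 0) (.of_forall fun b => ?_)).trans (by simp)
  simpa using h 0 (Fin.cons b y) a

end FinCons

section Concentration

theorem cosh_le_of_sq_le_convexComb {x y z θ : ℝ} (h0 : 0 ≤ θ) (h1 : θ ≤ 1)
    (h : z ^ 2 ≤ (1 - θ) * x ^ 2 + θ * y ^ 2) :
    Real.cosh z ≤ (1 - θ) * Real.cosh x + θ * Real.cosh y := by
  -- The power series of `cosh` in `x ^ 2` has nonnegative coefficients, and each `n`-th power is
  -- convex on `[0, ∞)`.
  refine hasSum_le (fun n => ?_) (Real.hasSum_cosh z)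
    (((Real.hasSum_cosh x).mul_left (1 - θ)).add ((Real.hasSum_cosh y).mul_left θ))
  have hconv : ((1 - θ) * x ^ 2 + θ * y ^ 2) ^ n ≤ (1 - θ) * (x ^ 2) ^ n + θ * (y ^ 2) ^ n :=
    (convexOn_pow n).2 (sq_nonneg x) (sq_nonneg y) (sub_nonneg.2 h1) h0 (by ring)
  have hpow := (pow_le_pow_left₀ (sq_nonneg z) h n).trans hconv
  simp only [← pow_mul] at hpow
  rw [← mul_div_assoc, ← mul_div_assoc, ← add_div]
  gcongr

theorem half_exp_le_cosh (x : ℝ) : Real.exp x / 2 ≤ Real.cosh x := by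
  rw [Real.cosh_eq]
  linarith [Real.exp_pos (-x)]

theorem half_exp_mul_measureReal_le_integral_cosh {Ω : Type*} [MeasurableSpace Ω] {μ : Measure Ω}
    [IsFiniteMeasure μ] {X : Ω → ℝ} (hX : ∀ ω, 0 ≤ X ω) {r s : ℝ}
    (hint : Integrable (fun ω => Real.cosh (s * X ω)) μ) (hr : 0 ≤ r) (hs : 0 ≤ s) :
    Real.exp (s * r) / 2 * μ.real {ω | r ≤ X ω} ≤ ∫ ω, Real.cosh (s * X ω) ∂μ := by
  have hsub : {ω | r ≤ X ω} ⊆ {ω | Real.exp (s * r) / 2 ≤ Real.cosh (s * X ω)} := by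
    intro ω (hω : r ≤ X ω)
    refine (half_exp_le_cosh _).trans (Real.cosh_le_cosh.2 ?_)
    rw [abs_of_nonneg (mul_nonneg hs hr), abs_of_nonneg (mul_nonneg hs (hX ω))]
    gcongr
  calc Real.exp (s * r) / 2 * μ.real {ω | r ≤ X ω}
      ≤ Real.exp (s * r) / 2 * μ.real {ω | Real.exp (s * r) / 2 ≤ Real.cosh (s * X ω)} :=
        mul_le_mul_of_nonneg_left (measureReal_mono hsub) (by positivity)
    _ ≤ ∫ ω, Real.cosh (s * X ω) ∂μ :=
        mul_meas_ge_le_integral_of_nonneg (.of_forall fun ω => (Real.cosh_pos _).le) hint _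

theorem integrable_cosh_norm {Ω E : Type*} [MeasurableSpace Ω] {μ : Measure Ω}
    [IsFiniteMeasure μ] [NormedAddCommGroup E] {X : Ω → E} (hX : AEStronglyMeasurable X μ) {R : ℝ}
    (hR : ∀ᵐ ω ∂μ, ‖X ω‖ ≤ R) : Integrable (fun ω => Real.cosh ‖X ω‖) μ := by
  refine .of_bound (Real.continuous_cosh.comp_aestronglyMeasurable hX.norm) (Real.cosh R) ?_
  filter_upwards [hR] with ω hω
  rw [Real.norm_of_nonneg (Real.cosh_pos _).le, Real.cosh_le_cosh, abs_norm]
  exact hω.trans (le_abs_self R)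

theorem HasBoundedDifferences.integrable_cosh_norm_sub {ι : Type*} [Finite ι] [DecidableEq ι]
    {α : ι → Type*} [∀ i, MeasurableSpace (α i)] {E : Type*} [NormedAddCommGroup E]
    {F : (∀ i, α i) → E} {c : ι → ℝ} (h : HasBoundedDifferences F c) (hF : StronglyMeasurable F)
    (μ : Measure (∀ i, α i)) [IsProbabilityMeasure μ] (e : E) :
    Integrable (fun x => Real.cosh ‖F x - e‖) μ := by
  have := Fintype.ofFinite ι
  obtain ⟨y⟩ := μ.nonempty_of_neZero
  exact integrable_cosh_norm (hF.sub stronglyMeasurable_const).aestronglyMeasurable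
    (.of_forall fun x => (_root_.norm_sub_le _ _).trans (add_le_add (h.norm_le y x) le_rfl))

variable {E : Type*} [NormedAddCommGroup E] [InnerProductSpace ℝ E]

/-- The right-hand side is affine in `x`, with equality at `x = ± (c / ‖v‖) • v`; its last term
averages to zero over a centred `x`. -/
theorem cosh_norm_add_le {x : E} {c : ℝ} (hx : ‖x‖ ≤ c) (v : E) :
    Real.cosh ‖v + x‖ ≤ Real.cosh ‖v‖ * Real.cosh c +
      Real.sinh ‖v‖ * Real.sinh c / (‖v‖ * c) * inner ℝ v x := by
  have hc : 0 ≤ c := (norm_nonneg x).trans hx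
  rcases hc.eq_or_lt with rfl | hc
  · simp [norm_le_zero_iff.1 hx]
  rcases eq_or_ne v 0 with rfl | hv
  · simpa [abs_of_pos hc] using hx
  have hvc : 0 < ‖v‖ * c := mul_pos (norm_pos_iff.2 hv) hc
  obtain ⟨s, hs⟩ : ∃ s : ℝ, inner ℝ v x = s * (‖v‖ * c) := ⟨_, (div_mul_cancel₀ _ hvc.ne').symm⟩
  have hs1 : |s| ≤ 1 := by
    refine le_of_mul_le_mul_right ?_ hvc
    calc |s| * (‖v‖ * c) = |inner ℝ v x| := by rw [hs, abs_mul, abs_of_pos hvc]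
      _ ≤ ‖v‖ * ‖x‖ := abs_real_inner_le_norm v x
      _ ≤ 1 * (‖v‖ * c) := by rw [one_mul]; gcongr
  have hsq : ‖v + x‖ ^ 2 ≤ (1 - (1 + s) / 2) * (‖v‖ - c) ^ 2 + (1 + s) / 2 * (‖v‖ + c) ^ 2 := by
    rw [norm_add_sq_real, hs]
    linarith [pow_le_pow_left₀ (norm_nonneg x) hx 2]
  have hcosh := cosh_le_of_sq_le_convexComb (by linarith [neg_le_of_abs_le hs1])
    (by linarith [le_of_abs_le hs1]) hsq
  rw [Real.cosh_sub, Real.cosh_add] at hcosh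
  rw [hs, div_mul_eq_mul_div, mul_div_assoc, mul_div_cancel_right₀ s hvc.ne']
  linarith

variable [CompleteSpace E]

theorem integral_cosh_norm_add_le {Ω : Type*} [MeasurableSpace Ω] {μ : Measure Ω}
    [IsProbabilityMeasure μ] {X : Ω → E} (hX : AEStronglyMeasurable X μ) (hX0 : ∫ ω, X ω ∂μ = 0)
    {c : ℝ} (hc : ∀ᵐ ω ∂μ, ‖X ω‖ ≤ c) (v : E) :
    ∫ ω, Real.cosh ‖v + X ω‖ ∂μ ≤ Real.cosh ‖v‖ * Real.exp (c ^ 2 / 2) := by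
  have hXint : Integrable X μ := .of_bound hX c hc
  set b := Real.sinh ‖v‖ * Real.sinh c / (‖v‖ * c)
  have hint : Integrable (fun ω => b * inner ℝ v (X ω)) μ := (hXint.const_inner v).const_mul b
  calc ∫ ω, Real.cosh ‖v + X ω‖ ∂μ
      ≤ ∫ ω, (Real.cosh ‖v‖ * Real.cosh c + b * inner ℝ v (X ω)) ∂μ := by
        refine integral_mono_ae ?_ ((integrable_const _).add hint) ?_
        · refine integrable_cosh_norm (R := ‖v‖ + c) (hX.const_add v) ?_
          filter_upwards [hc] with ω hω
          exact (norm_add_le _ _).trans (by gcongr)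
        · filter_upwards [hc] with ω hω using cosh_norm_add_le hω v
    _ = Real.cosh ‖v‖ * Real.cosh c + b * inner ℝ v (∫ ω, X ω ∂μ) := by
        rw [integral_add (integrable_const _) hint, integral_const, probReal_univ, one_smul,
          integral_const_mul, integral_inner hXint]
    _ ≤ Real.cosh ‖v‖ * Real.exp (c ^ 2 / 2) := by
        rw [hX0, inner_zero_right, mul_zero, add_zero]
        gcongr
        exact Real.cosh_le_exp_half_sq c

theorem HasBoundedDifferences.integral_cosh_norm_cons_sub_le {n : ℕ} {α : Fin (n + 1) → Type*}
    [∀ i, MeasurableSpace (α i)] (μ : ∀ i, Measure (α i)) [∀ i, IsProbabilityMeasure (μ i)]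
    {F : (∀ i, α i) → E} {c : Fin (n + 1) → ℝ} (h : HasBoundedDifferences F c)
    (hF : StronglyMeasurable F) (e : E) (y : ∀ i : Fin n, α i.succ) :
    ∫ a, Real.cosh ‖F (Fin.cons a y) - e‖ ∂μ 0 ≤
      Real.cosh ‖(∫ a, F (Fin.cons a y) ∂μ 0) - e‖ * Real.exp (c 0 ^ 2 / 2) := by
  set g := ∫ a, F (Fin.cons a y) ∂μ 0
  have hint := h.integrable_cons μ hF y
  have hcentred : ∫ a, (F (Fin.cons a y) - g) ∂μ 0 = 0 := by
    rw [integral_sub hint (integrable_const _), integral_const, probReal_univ, one_smul, sub_self]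
  have hle := integral_cosh_norm_add_le (hint.sub (integrable_const g)).aestronglyMeasurable
    hcentred (.of_forall fun a => h.norm_cons_sub_integral_le μ hF a y) (g - e)
  simpa only [Pi.sub_apply, add_comm (g - e), sub_add_sub_cancel] using hle

theorem HasBoundedDifferences.integral_cosh_norm_sub_le_fin {n : ℕ} {α : Fin n → Type*}
    [∀ i, MeasurableSpace (α i)] (μ : ∀ i, Measure (α i)) [∀ i, IsProbabilityMeasure (μ i)]
    {F : (∀ i, α i) → E} {c : Fin n → ℝ} (h : HasBoundedDifferences F c)
    (hF : StronglyMeasurable F) :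
    ∫ x, Real.cosh ‖F x - ∫ z, F z ∂Measure.pi μ‖ ∂Measure.pi μ ≤
      Real.exp ((∑ i, c i ^ 2) / 2) := by
  induction n with
  | zero =>
    obtain ⟨y⟩ := (Measure.pi μ).nonempty_of_neZero
    have hFy : ∀ x, F x = F y := fun x => congrArg F (Subsingleton.elim x y)
    simp [hFy]
  | succ n ih =>
    set ν := Measure.pi fun i : Fin n => μ i.succ
    set G : (∀ i : Fin n, α i.succ) → E := fun y => ∫ a, F (Fin.cons a y) ∂μ 0
    set e := ∫ z, F z ∂Measure.pi μ
    have hG := h.integral_cons μ hF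
    have hGmeas := stronglyMeasurable_integral_cons μ hF
    have hGe : ∫ y, G y ∂ν = e := (integral_pi_eq_integral_cons μ (h.integrable hF _)).symm
    calc ∫ x, Real.cosh ‖F x - e‖ ∂Measure.pi μ
        = ∫ y, ∫ a, Real.cosh ‖F (Fin.cons a y) - e‖ ∂μ 0 ∂ν :=
          integral_pi_eq_integral_cons μ (h.integrable_cosh_norm_sub hF _ e)
      _ ≤ ∫ y, Real.cosh ‖G y - e‖ * Real.exp (c 0 ^ 2 / 2) ∂ν :=
          integral_mono_of_nonneg (.of_forall fun y => integral_nonneg fun a =>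
            (Real.cosh_pos _).le) ((hG.integrable_cosh_norm_sub hGmeas _ e).mul_const _)
            (.of_forall (h.integral_cosh_norm_cons_sub_le μ hF e))
      _ ≤ Real.exp ((∑ i : Fin n, c i.succ ^ 2) / 2) * Real.exp (c 0 ^ 2 / 2) := by
          rw [integral_mul_const, ← hGe]
          gcongr
          exact ih _ hG hGmeas
      _ = Real.exp ((∑ i, c i ^ 2) / 2) := by
          rw [← Real.exp_add, Fin.sum_univ_succ]
          ring_nf

theorem HasBoundedDifferences.integral_cosh_norm_sub_le {ι : Type*} [Fintype ι] [DecidableEq ι]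
    {α : ι → Type*} [∀ i, MeasurableSpace (α i)] (μ : ∀ i, Measure (α i))
    [∀ i, IsProbabilityMeasure (μ i)] {F : (∀ i, α i) → E} {c : ι → ℝ}
    (h : HasBoundedDifferences F c) (hF : StronglyMeasurable F) :
    ∫ x, Real.cosh ‖F x - ∫ z, F z ∂Measure.pi μ‖ ∂Measure.pi μ ≤
      Real.exp ((∑ i, c i ^ 2) / 2) := by
  let e := (Fintype.equivFin ι).symm
  let Φ := MeasurableEquiv.piCongrLeft α e
  have hΦ : MeasurePreserving Φ (Measure.pi fun i => μ (e i)) (Measure.pi μ) :=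
    measurePreserving_piCongrLeft μ e
  have hFΦ : HasBoundedDifferences (fun x => F (Φ x)) fun i => c (e i) := by
    intro i x a
    have hupdate : Φ (Function.update x i a) = Function.update (Φ x) (e i) a := by
      ext j
      obtain ⟨k, rfl⟩ := e.surjective j
      rcases eq_or_ne k i with rfl | hk
      · simp [Φ, MeasurableEquiv.coe_piCongrLeft]
      · simp [Φ, MeasurableEquiv.coe_piCongrLeft, hk]
    change ‖F (Φ (Function.update x i a)) - F (Φ x)‖ ≤ c (e i)
    rw [hupdate]
    exact h _ _ _
  have hle := hFΦ.integral_cosh_norm_sub_le_fin (fun i => μ (e i))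
    (hF.comp_measurable hΦ.measurable)
  rwa [hΦ.integral_comp' F, hΦ.integral_comp' fun x => Real.cosh ‖F x - ∫ z, F z ∂Measure.pi μ‖,
    e.sum_comp fun i => c i ^ 2] at hle

/-- **McDiarmid's inequality** in a Hilbert space. -/
theorem HasBoundedDifferences.measureReal_le_norm_sub_le {ι : Type*} [Fintype ι] [DecidableEq ι]
    {α : ι → Type*} [∀ i, MeasurableSpace (α i)] (μ : ∀ i, Measure (α i))
    [∀ i, IsProbabilityMeasure (μ i)] {F : (∀ i, α i) → E} {c : ι → ℝ}
    (h : HasBoundedDifferences F c) (hF : StronglyMeasurable F) {V r : ℝ} (hV : 0 < V)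
    (hc : ∑ i, c i ^ 2 ≤ V) (hr : 0 ≤ r) :
    (Measure.pi μ).real {x | r ≤ ‖F x - ∫ z, F z ∂Measure.pi μ‖} ≤
      2 * Real.exp (-(r ^ 2 / (2 * V))) := by
  set e := ∫ z, F z ∂Measure.pi μ
  set s := r / V with hs
  have hs0 : 0 ≤ s := div_nonneg hr hV.le
  have hscale : ∀ x, Real.cosh ‖s • F x - ∫ z, s • F z ∂Measure.pi μ‖ =
      Real.cosh (s * ‖F x - e‖) := by
    intro x
    rw [integral_smul, ← smul_sub, norm_smul, Real.norm_of_nonneg hs0]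
  have hint := (h.const_smul hs0).integrable_cosh_norm_sub (hF.const_smul s) (Measure.pi μ)
    (∫ z, s • F z ∂Measure.pi μ)
  have hle := (h.const_smul hs0).integral_cosh_norm_sub_le μ (hF.const_smul s)
  simp only [hscale] at hint hle
  have hmarkov : Real.exp (s * r) / 2 * (Measure.pi μ).real {x | r ≤ ‖F x - e‖} ≤
      Real.exp (s ^ 2 * V / 2) := by
    calc Real.exp (s * r) / 2 * (Measure.pi μ).real {x | r ≤ ‖F x - e‖}
        ≤ ∫ x, Real.cosh (s * ‖F x - e‖) ∂Measure.pi μ :=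
          half_exp_mul_measureReal_le_integral_cosh (fun x => norm_nonneg (F x - e)) hint hr hs0
      _ ≤ Real.exp ((∑ i, (s * c i) ^ 2) / 2) := hle
      _ ≤ Real.exp (s ^ 2 * V / 2) := by
          simp only [mul_pow, ← Finset.mul_sum]
          gcongr
  have hexp : Real.exp (s ^ 2 * V / 2) = Real.exp (-(r ^ 2 / (2 * V))) * Real.exp (s * r) := by
    rw [← Real.exp_add, hs]
    congr 1
    field_simp
    ring
  rw [hexp] at hmarkov
  exact le_of_mul_le_mul_right (by linarith) (Real.exp_pos (s * r))

end Concentration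

section Independent

section ExtendWithin

variable {ι : Type*} [DecidableEq ι] {α : ι → Type*} {S : ∀ i, Set (α i)} {x₀ : ∀ i, α i}
  {s : Finset ι}

open Classical in
/-- The family that agrees with `y` at those `i ∈ s` where `y i ∈ S i`, and with `x₀` at all other
indices. Precomposition with it turns a function on `∏ i, α i` whose differences are bounded only on
`∏ i, S i` into a function of the finitely many arguments in `s` with bounded differences. -/
noncomputable def extendWithin (S : ∀ i, Set (α i)) (x₀ : ∀ i, α i) (y : ∀ i : s, α i) (i : ι) :
    α i :=
  if h : i ∈ s then if y ⟨i, h⟩ ∈ S i then y ⟨i, h⟩ else x₀ i else x₀ i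

theorem extendWithin_mem (hx₀ : ∀ i, x₀ i ∈ S i) (y : ∀ i : s, α i) (i : ι) :
    extendWithin S x₀ y i ∈ S i := by
  unfold extendWithin
  split_ifs with _ hy <;> first | exact hy | exact hx₀ i

theorem extendWithin_apply {y : ∀ i : s, α i} (i : s) (hy : y i ∈ S i) :
    extendWithin S x₀ y i = y i := by
  simp only [extendWithin, i.2, hy, dite_true, if_true]

theorem extendWithin_update (y : ∀ i : s, α i) (i : s) (a : α i) :
    extendWithin S x₀ (Function.update y i a) =
      Function.update (extendWithin S x₀ y) i (extendWithin S x₀ (Function.update y i a) i) := by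
  classical
  refine Function.eq_update_iff.2 ⟨rfl, fun j hj => ?_⟩
  by_cases h : j ∈ s
  · have hji : Function.update y i a ⟨j, h⟩ = y ⟨j, h⟩ :=
      Function.update_of_ne (fun hji => hj (congrArg Subtype.val hji)) _ _
    simp only [extendWithin, h, dite_true]
    exact if_congr (iff_of_eq (congrArg (· ∈ S j) hji)) hji rfl
  · simp only [extendWithin, h, dite_false]

theorem measurable_extendWithin [∀ i, MeasurableSpace (α i)] (hS : ∀ i, MeasurableSet (S i)) :
    Measurable (extendWithin S x₀ : (∀ i : s, α i) → ∀ i, α i) := by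
  refine measurable_pi_lambda _ fun i => ?_
  by_cases hi : i ∈ s
  · simp only [extendWithin, hi, dite_true]
    exact Measurable.ite (measurable_pi_apply _ (hS i)) (measurable_pi_apply _) measurable_const
  · simp only [extendWithin, hi, dite_false, measurable_const]

end ExtendWithin

variable {Ω : Type*} [MeasurableSpace Ω] {μ : Measure Ω} [IsProbabilityMeasure μ]
  {E : Type*} [NormedAddCommGroup E] [InnerProductSpace ℝ E] [CompleteSpace E]

theorem HasBoundedDifferences.measureReal_le_norm_sub_le_of_iIndepFun {ι : Type*} [Fintype ι]
    [DecidableEq ι] {α : ι → Type*} [∀ i, MeasurableSpace (α i)] {X : ∀ i, Ω → α i}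
    (hX : ∀ i, Measurable (X i)) (hindep : iIndepFun X μ) {F : (∀ i, α i) → E} {c : ι → ℝ}
    (h : HasBoundedDifferences F c) (hF : StronglyMeasurable F) {V r : ℝ} (hV : 0 < V)
    (hc : ∑ i, c i ^ 2 ≤ V) (hr : 0 ≤ r) :
    μ.real {ω | r ≤ ‖F (fun i => X i ω) - ∫ ω', F (fun i => X i ω') ∂μ‖} ≤
      2 * Real.exp (-(r ^ 2 / (2 * V))) := by
  have hlaw : μ.map (fun ω i => X i ω) = Measure.pi fun i => μ.map (X i) :=
    (iIndepFun_iff_map_fun_eq_pi_map fun i => (hX i).aemeasurable).1 hindep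
  have hXmeas : Measurable fun ω i => X i ω := measurable_pi_lambda _ hX
  have hprob : ∀ i, IsProbabilityMeasure (μ.map (X i)) := fun i =>
    Measure.isProbabilityMeasure_map (hX i).aemeasurable
  have hdist : ∀ e, Measurable fun x => ‖F x - e‖ := fun e =>
    (hF.sub stronglyMeasurable_const).norm.measurable
  have htail := h.measureReal_le_norm_sub_le (fun i => μ.map (X i)) hF hV hc hr
  rwa [← hlaw, integral_map hXmeas.aemeasurable hF.aestronglyMeasurable,
    map_measureReal_apply hXmeas (measurableSet_le measurable_const (hdist _))] at htail

theorem measureReal_le_norm_sub_integral_le_of_iIndepFun {ι : Type*} [DecidableEq ι]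
    {α : ι → Type*} [∀ i, MeasurableSpace (α i)] {X : ∀ i, Ω → α i} (hX : ∀ i, Measurable (X i))
    (hindep : iIndepFun X μ) {S : ∀ i, Set (α i)} (hS : ∀ i, MeasurableSet (S i))
    (hXS : ∀ i, ∀ᵐ ω ∂μ, X i ω ∈ S i) {s : Finset ι} {F : (∀ i, α i) → E}
    (hF : StronglyMeasurable F) (hFs : DependsOn F s) {c : ι → ℝ}
    (hc : ∀ i ∈ s, ∀ x, (∀ j, x j ∈ S j) → ∀ a ∈ S i, ‖F (Function.update x i a) - F x‖ ≤ c i)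
    {V r : ℝ} (hV : 0 < V) (hcV : ∑ i ∈ s, c i ^ 2 ≤ V) (hr : 0 ≤ r) :
    μ.real {ω | r ≤ ‖F (fun i => X i ω) - ∫ ω', F (fun i => X i ω') ∂μ‖} ≤
      2 * Real.exp (-(r ^ 2 / (2 * V))) := by
  choose z hz using fun i => (hXS i).exists
  let x₀ : ∀ i, α i := fun i => X i (z i)
  have hbdd : HasBoundedDifferences (fun y => F (extendWithin S x₀ y)) fun i : s => c i := by
    intro i y a
    change ‖F (extendWithin S x₀ (Function.update y i a)) - F (extendWithin S x₀ y)‖ ≤ c i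
    rw [extendWithin_update]
    exact hc i i.2 _ (extendWithin_mem hz y) _ (extendWithin_mem hz _ _)
  have hΦX : ∀ᵐ ω ∂μ, F (extendWithin S x₀ fun i : s => X i ω) = F fun i => X i ω := by
    filter_upwards [(ae_ball_iff s.countable_toSet).2 fun i _ => hXS i] with ω hω
    exact hFs fun i hi => extendWithin_apply ⟨i, hi⟩ (hω i hi)
  have htail := hbdd.measureReal_le_norm_sub_le_of_iIndepFun (fun i : s => hX i)
    (hindep.precomp Subtype.val_injective) (hF.comp_measurable (measurable_extendWithin hS)) hV
    ((Finset.sum_coe_sort s fun i => c i ^ 2).trans_le hcV) hr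
  rw [integral_congr_ae hΦX] at htail
  refine (measureReal_congr ?_).trans_le htail
  filter_upwards [hΦX] with ω hω
  exact congrArg (fun v => r ≤ ‖v - _‖) hω.symm

end Independent

section Norms

variable {m n : Type*}

/-- The vector of entries of a matrix. Its Euclidean norm is the Frobenius norm of the matrix; the
concentration inequality needs this Hilbert norm, because the spectral norm is not one. -/
def entries : Matrix m n ℝ →ₗ[ℝ] EuclideanSpace ℝ (m × n) where
  toFun M := WithLp.toLp 2 fun p => M p.1 p.2
  map_add' _ _ := rfl
  map_smul' _ _ := rfl

theorem entries_apply (M : Matrix m n ℝ) (p : m × n) : entries M p = M p.1 p.2 := rfl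

variable [Fintype m] [Fintype n]

theorem norm_mulVec_le [DecidableEq n] (M : Matrix m n ℝ) (v : n → ℝ) :
    ‖WithLp.toLp 2 (M *ᵥ v)‖ ≤ ‖M‖ * ‖WithLp.toLp 2 v‖ :=
  Matrix.l2_opNorm_mulVec M (WithLp.toLp 2 v)

theorem opNorm_le_of_norm_mulVec_le [DecidableEq n] {M : Matrix m n ℝ} {c : ℝ} (hc : 0 ≤ c)
    (h : ∀ v : n → ℝ, ‖WithLp.toLp 2 (M *ᵥ v)‖ ≤ c * ‖WithLp.toLp 2 v‖) : ‖M‖ ≤ c := by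
  rw [Matrix.l2_opNorm_def]
  exact ContinuousLinearMap.opNorm_le_bound _ hc fun x => h x.ofLp

theorem dotProduct_le_norm_mul_norm (u v : n → ℝ) :
    u ⬝ᵥ v ≤ ‖WithLp.toLp 2 u‖ * ‖WithLp.toLp 2 v‖ := by
  simpa only [dotProduct_comm, star_trivial, EuclideanSpace.inner_toLp_toLp] using
    real_inner_le_norm (WithLp.toLp 2 u) (WithLp.toLp 2 v)

theorem opNorm_one_le [DecidableEq n] : ‖(1 : Matrix n n ℝ)‖ ≤ 1 :=
  opNorm_le_of_norm_mulVec_le zero_le_one fun v => by rw [Matrix.one_mulVec, one_mul]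

theorem opNorm_transpose [DecidableEq m] [DecidableEq n] (M : Matrix m n ℝ) : ‖Mᵀ‖ = ‖M‖ := by
  rw [← Matrix.conjTranspose_eq_transpose_of_trivial, Matrix.l2_opNorm_conjTranspose]

theorem norm_entries_sq (M : Matrix m n ℝ) : ‖entries M‖ ^ 2 = ∑ a, ∑ b, M a b ^ 2 := by
  rw [EuclideanSpace.real_norm_sq_eq, Fintype.sum_prod_type]
  rfl

theorem opNorm_le_norm_entries [DecidableEq n] (M : Matrix m n ℝ) : ‖M‖ ≤ ‖entries M‖ := by
  refine opNorm_le_of_norm_mulVec_le (norm_nonneg _) fun v => le_of_sq_le_sq ?_ (by positivity)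
  rw [mul_pow, norm_entries_sq, EuclideanSpace.real_norm_sq_eq, EuclideanSpace.real_norm_sq_eq,
    Finset.sum_mul]
  exact Finset.sum_le_sum fun a _ => Finset.sum_mul_sq_le_sq_mul_sq _ _ _

theorem norm_entries_vecMulVec (u : m → ℝ) (v : n → ℝ) :
    ‖entries (Matrix.vecMulVec u v)‖ = ‖WithLp.toLp 2 u‖ * ‖WithLp.toLp 2 v‖ := by
  rw [← sq_eq_sq₀ (norm_nonneg _) (by positivity), mul_pow, norm_entries_sq]
  simp only [EuclideanSpace.real_norm_sq_eq, Finset.sum_mul_sum, Matrix.vecMulVec_apply, mul_pow]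

end Norms

section BlockRow

variable {d₁ d₂ q : ℕ}

theorem norm_entries_blockRow_sq (N : ℕ → Matrix (Fin d₁) (Fin d₂) ℝ) :
    ‖entries (blockRow q N)‖ ^ 2 = ∑ l : Fin q, ‖entries (N l)‖ ^ 2 := by
  simp only [norm_entries_sq, Fintype.sum_prod_type]
  rw [Finset.sum_comm]
  rfl

theorem opNorm_blockRow_le {N : ℕ → Matrix (Fin d₁) (Fin d₂) ℝ} {ε : ℝ} (hε : 0 ≤ ε)
    (hN : ∀ l < q, ‖entries (N l)‖ ≤ ε) : ‖blockRow q N‖ ≤ √q * ε := by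
  refine (opNorm_le_norm_entries _).trans (le_of_sq_le_sq ?_ (by positivity))
  calc ‖entries (blockRow q N)‖ ^ 2 = ∑ l : Fin q, ‖entries (N l)‖ ^ 2 :=
        norm_entries_blockRow_sq N
    _ ≤ ∑ _l : Fin q, ε ^ 2 :=
        Finset.sum_le_sum fun l _ => pow_le_pow_left₀ (norm_nonneg _) (hN l l.2) 2
    _ = (√q * ε) ^ 2 := by
        rw [Finset.sum_const, Finset.card_univ, Fintype.card_fin, nsmul_eq_mul, mul_pow,
          Real.sq_sqrt (Nat.cast_nonneg q)]

end BlockRow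

section LeastSquares

variable {m n : Type*} [Fintype m] [Fintype n] [DecidableEq m] {C C' : Matrix m n ℝ} {c κ : ℝ}

theorem isUnit_mul_transpose_of_norm_le
    (h : ∀ y, ‖WithLp.toLp 2 y‖ ≤ c * ‖WithLp.toLp 2 (Cᵀ *ᵥ y)‖) : IsUnit (C * Cᵀ) := by
  rw [← Matrix.mulVec_injective_iff_isUnit, ← Matrix.coe_mulVecLin, injective_iff_map_eq_zero]
  intro y hy
  have hCy : Cᵀ *ᵥ y = 0 := by
    simpa only [Matrix.mulVecLin_apply, ← Matrix.conjTranspose_eq_transpose_of_trivial,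
      Matrix.self_mul_conjTranspose_mulVec_eq_zero] using hy
  have hy0 := h y
  rw [hCy, WithLp.toLp_zero, norm_zero, mul_zero, norm_le_zero_iff] at hy0
  exact congrArg WithLp.ofLp hy0

theorem mulVec_inv_mulVec_cancel {M : Matrix m m ℝ} (hM : IsUnit M) (v : m → ℝ) :
    M *ᵥ (M⁻¹ *ᵥ v) = v := by
  rw [Matrix.mulVec_mulVec, Matrix.mul_nonsing_inv _ ((Matrix.isUnit_iff_isUnit_det _).1 hM),
    Matrix.one_mulVec]

theorem norm_sq_transpose_mulVec_inv (hC : IsUnit (C * Cᵀ)) (v : m → ℝ) :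
    ‖WithLp.toLp 2 (Cᵀ *ᵥ ((C * Cᵀ)⁻¹ *ᵥ v))‖ ^ 2 = ((C * Cᵀ)⁻¹ *ᵥ v) ⬝ᵥ v := by
  nth_rw 3 [← mulVec_inv_mulVec_cancel hC v]
  rw [← Matrix.mulVec_mulVec, Matrix.dotProduct_mulVec, ← Matrix.mulVec_transpose,
    ← real_inner_self_eq_norm_sq, EuclideanSpace.inner_toLp_toLp, star_trivial]

theorem opNorm_transpose_mul_inv_le (hc : 0 ≤ c)
    (h : ∀ y, ‖WithLp.toLp 2 y‖ ≤ c * ‖WithLp.toLp 2 (Cᵀ *ᵥ y)‖) : ‖Cᵀ * (C * Cᵀ)⁻¹‖ ≤ c := by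
  refine opNorm_le_of_norm_mulVec_le hc fun v => ?_
  rw [← Matrix.mulVec_mulVec]
  set y := (C * Cᵀ)⁻¹ *ᵥ v
  have hsq : ‖WithLp.toLp 2 (Cᵀ *ᵥ y)‖ ^ 2 ≤
      (c * ‖WithLp.toLp 2 v‖) * ‖WithLp.toLp 2 (Cᵀ *ᵥ y)‖ := by
    calc ‖WithLp.toLp 2 (Cᵀ *ᵥ y)‖ ^ 2 = y ⬝ᵥ v :=
          norm_sq_transpose_mulVec_inv (isUnit_mul_transpose_of_norm_le h) v
      _ ≤ ‖WithLp.toLp 2 y‖ * ‖WithLp.toLp 2 v‖ := dotProduct_le_norm_mul_norm y v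
      _ ≤ c * ‖WithLp.toLp 2 (Cᵀ *ᵥ y)‖ * ‖WithLp.toLp 2 v‖ := by gcongr; exact h y
      _ = _ := by ring
  rcases (norm_nonneg (WithLp.toLp 2 (Cᵀ *ᵥ y))).eq_or_lt with h0 | hpos
  · rw [← h0]; positivity
  · exact le_of_mul_le_mul_right (by rwa [← sq]) hpos

theorem norm_le_sqrt_mul_norm_transpose_mulVec (hC : IsUnit (C * Cᵀ)) (hκ : ‖(C * Cᵀ)⁻¹‖ ≤ κ)
    (y : m → ℝ) : ‖WithLp.toLp 2 y‖ ≤ √κ * ‖WithLp.toLp 2 (Cᵀ *ᵥ y)‖ := by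
  have hκ0 : 0 ≤ κ := (norm_nonneg _).trans hκ
  have hinv : ‖WithLp.toLp 2 (Cᵀ *ᵥ ((C * Cᵀ)⁻¹ *ᵥ y))‖ ≤ √κ * ‖WithLp.toLp 2 y‖ := by
    refine le_of_sq_le_sq ?_ (by positivity)
    rw [norm_sq_transpose_mulVec_inv hC, mul_pow, Real.sq_sqrt hκ0, sq, ← mul_assoc]
    refine (dotProduct_le_norm_mul_norm _ _).trans ?_
    gcongr
    exact (norm_mulVec_le _ _).trans (by gcongr)
  have hsq : ‖WithLp.toLp 2 y‖ * ‖WithLp.toLp 2 y‖ ≤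
      √κ * ‖WithLp.toLp 2 (Cᵀ *ᵥ y)‖ * ‖WithLp.toLp 2 y‖ := by
    calc ‖WithLp.toLp 2 y‖ * ‖WithLp.toLp 2 y‖ = y ⬝ᵥ ((C * Cᵀ) *ᵥ ((C * Cᵀ)⁻¹ *ᵥ y)) := by
          rw [mulVec_inv_mulVec_cancel hC, ← real_inner_self_eq_norm_mul_norm,
            EuclideanSpace.inner_toLp_toLp, star_trivial]
      _ = (Cᵀ *ᵥ y) ⬝ᵥ (Cᵀ *ᵥ ((C * Cᵀ)⁻¹ *ᵥ y)) := by
          rw [← Matrix.mulVec_mulVec, Matrix.dotProduct_mulVec, ← Matrix.mulVec_transpose]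
      _ ≤ ‖WithLp.toLp 2 (Cᵀ *ᵥ y)‖ * (√κ * ‖WithLp.toLp 2 y‖) :=
          (dotProduct_le_norm_mul_norm _ _).trans (by gcongr)
      _ = _ := by ring
  rcases (norm_nonneg (WithLp.toLp 2 y)).eq_or_lt with h0 | hpos
  · rw [← h0]; positivity
  · exact le_of_mul_le_mul_right hsq hpos

theorem norm_le_two_mul_norm_transpose_mulVec_of_close (hc : 0 < c)
    (h : ∀ y, ‖WithLp.toLp 2 y‖ ≤ c * ‖WithLp.toLp 2 (Cᵀ *ᵥ y)‖) (hCC' : ‖(C' - C)ᵀ‖ ≤ 1 / (2 * c))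
    (y : m → ℝ) : ‖WithLp.toLp 2 y‖ ≤ 2 * c * ‖WithLp.toLp 2 (C'ᵀ *ᵥ y)‖ := by
  have hdiff : ‖WithLp.toLp 2 (Cᵀ *ᵥ y)‖ ≤
      ‖WithLp.toLp 2 (C'ᵀ *ᵥ y)‖ + 1 / (2 * c) * ‖WithLp.toLp 2 y‖ := by
    have hsplit : Cᵀ *ᵥ y = C'ᵀ *ᵥ y - (C' - C)ᵀ *ᵥ y := by
      rw [← Matrix.sub_mulVec, Matrix.transpose_sub, sub_sub_cancel]
    rw [hsplit, WithLp.toLp_sub]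
    exact (norm_sub_le _ _).trans (by gcongr; exact (norm_mulVec_le _ _).trans (by gcongr))
  have habsorb : c * (1 / (2 * c) * ‖WithLp.toLp 2 y‖) = ‖WithLp.toLp 2 y‖ / 2 := by field_simp
  have := (h y).trans (mul_le_mul_of_nonneg_left hdiff hc.le)
  rw [mul_add, habsorb] at this
  linarith

theorem isUnit_and_opNorm_transpose_mul_inv_le_of_close [DecidableEq n] (hκ : 0 < κ)
    (hC : IsUnit (C * Cᵀ)) (hCκ : ‖(C * Cᵀ)⁻¹‖ ≤ κ) (hCC' : ‖C' - C‖ ≤ 1 / (2 * √κ)) :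
    IsUnit (C' * C'ᵀ) ∧ ‖C'ᵀ * (C' * C'ᵀ)⁻¹‖ ≤ 2 * √κ := by
  have hlower := norm_le_two_mul_norm_transpose_mulVec_of_close (Real.sqrt_pos.2 hκ)
    (norm_le_sqrt_mul_norm_transpose_mulVec hC hCκ) ((opNorm_transpose _).trans_le hCC')
  exact ⟨isUnit_mul_transpose_of_norm_le hlower, opNorm_transpose_mul_inv_le (by positivity) hlower⟩

end LeastSquares

section Estimates

variable {d₁ d₂ q : ℕ} {A : Matrix (Fin d₁) (Fin d₁) ℝ} {B : Matrix (Fin d₁) (Fin d₂) ℝ}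
  {K : Matrix (Fin d₂) (Fin d₁) ℝ} {κ γ ε : ℝ} {N : ℕ → Matrix (Fin d₁) (Fin d₂) ℝ}

theorem StronglyStable.norm_pow_le (h : StronglyStable A B K κ γ) (k : ℕ) :
    ‖(A - B * K) ^ k‖ ≤ κ ^ 2 * (1 - γ) ^ k := by
  obtain ⟨hκ, -, hγ1, -, L, H, hH, hA, hL, hHn, hHi⟩ := h
  have hdet := (Matrix.isUnit_iff_isUnit_det _).1 hH
  have hpow : (A - B * K) ^ k = H * L ^ k * H⁻¹ := by
    induction k with
    | zero => rw [pow_zero, pow_zero, mul_one, Matrix.mul_nonsing_inv _ hdet]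
    | succ k ih =>
      rw [pow_succ, ih, hA, pow_succ]
      simp only [Matrix.mul_assoc]
      rw [← Matrix.mul_assoc H⁻¹ H, Matrix.nonsing_inv_mul _ hdet, Matrix.one_mul]
  have hLk : ‖L ^ k‖ ≤ (1 - γ) ^ k := by
    rcases k.eq_zero_or_pos with rfl | hk
    · simpa only [pow_zero] using opNorm_one_le
    · exact (norm_pow_le' L hk).trans (pow_le_pow_left₀ (norm_nonneg _) hL k)
  calc ‖(A - B * K) ^ k‖ = ‖H * L ^ k * H⁻¹‖ := by rw [hpow]
    _ ≤ ‖H‖ * ‖L ^ k‖ * ‖H⁻¹‖ := (norm_mul_le _ _).trans (by gcongr; exact norm_mul_le _ _)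
    _ ≤ κ * (1 - γ) ^ k * κ := by gcongr
    _ = κ ^ 2 * (1 - γ) ^ k := by ring

theorem regressor_sub_controllabilityMatrix (M : Matrix (Fin d₁) (Fin d₁) ℝ)
    (B : Matrix (Fin d₁) (Fin d₂) ℝ) (N : ℕ → Matrix (Fin d₁) (Fin d₂) ℝ) :
    regressor q N - controllabilityMatrix M B q = blockRow q fun l => N l - M ^ l * B :=
  rfl

theorem response_sub_mul_controllabilityMatrix (M : Matrix (Fin d₁) (Fin d₁) ℝ)
    (B : Matrix (Fin d₁) (Fin d₂) ℝ) (N : ℕ → Matrix (Fin d₁) (Fin d₂) ℝ) :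
    response q N - M * controllabilityMatrix M B q =
      blockRow q fun l => N (l + 1) - M ^ (l + 1) * B := by
  have hshift : M * controllabilityMatrix M B q = blockRow q fun l => M ^ (l + 1) * B := by
    ext a p
    simp only [pow_succ', Matrix.mul_assoc]
    rfl
  rw [hshift]
  rfl

/-- The closed-loop matrix `A - B K` maps the exact regressor to the exact response, so only the
errors `C₁ - (A - B K) C` and `C₀ - C` enter. -/
theorem estimateA_sub (C : Matrix (Fin d₁) (Fin q × Fin d₂) ℝ)
    (hC₀ : IsUnit (regressor q N * (regressor q N)ᵀ)) :
    estimateA q K N - A =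
      ((response q N - (A - B * K) * C) - (A - B * K) * (regressor q N - C)) *
        ((regressor q N)ᵀ * (regressor q N * (regressor q N)ᵀ)⁻¹) + (estimateB N - B) * K := by
  set C₀ := regressor q N
  set C₁ := response q N with hC₁
  have hright : C₀ * (C₀ᵀ * (C₀ * C₀ᵀ)⁻¹) = 1 := by
    rw [← Matrix.mul_assoc, Matrix.mul_nonsing_inv _ ((Matrix.isUnit_iff_isUnit_det _).1 hC₀)]
  have hcancel : C₁ - (A - B * K) * C - (A - B * K) * (C₀ - C) = C₁ - (A - B * K) * C₀ := by
    rw [Matrix.mul_sub]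
    abel
  rw [hcancel, Matrix.sub_mul C₁, Matrix.mul_assoc _ C₀, hright, Matrix.mul_one,
    Matrix.sub_mul (estimateB N), estimateA, ← hC₁, Matrix.mul_assoc C₁]
  abel

theorem norm_estimateB_sub_le {M : Matrix (Fin d₁) (Fin d₁) ℝ}
    (hN : ‖entries (N 0 - M ^ 0 * B)‖ ≤ ε) : ‖estimateB N - B‖ ≤ ε := by
  rw [pow_zero, Matrix.one_mul] at hN
  exact (opNorm_le_norm_entries _).trans hN

theorem isUnit_and_norm_estimateA_sub_le (hκ : 1 ≤ κ) (hst : StronglyStable A B K κ γ)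
    (hco : StronglyControllable (A - B * K) B q κ)
    (hN : ∀ l ≤ q, ‖entries (N l - (A - B * K) ^ l * B)‖ ≤ ε) (hε : √q * ε ≤ 1 / (2 * √κ)) :
    IsUnit (regressor q N * (regressor q N)ᵀ) ∧
      ‖estimateA q K N - A‖ ≤ 5 * √κ * κ ^ 2 * (√q * ε) := by
  obtain ⟨hq, hC, hCκ⟩ := hco
  set C := controllabilityMatrix (A - B * K) B q
  set η := √q * ε
  have hε0 : 0 ≤ ε := (norm_nonneg _).trans (hN 0 q.zero_le)
  have hη0 : 0 ≤ η := by positivity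
  have hregressor : ‖regressor q N - C‖ ≤ η := by
    rw [regressor_sub_controllabilityMatrix]
    exact opNorm_blockRow_le hε0 fun l hl => hN l hl.le
  have hresponse : ‖response q N - (A - B * K) * C‖ ≤ η := by
    rw [response_sub_mul_controllabilityMatrix]
    exact opNorm_blockRow_le hε0 fun l hl => hN (l + 1) hl
  have hloop : ‖A - B * K‖ ≤ κ ^ 2 := by
    have := hst.norm_pow_le 1
    rw [pow_one, pow_one] at this
    exact this.trans (mul_le_of_le_one_right (sq_nonneg κ) (by linarith [hst.2.1]))
  have hB : ‖estimateB N - B‖ ≤ η :=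
    (norm_estimateB_sub_le (hN 0 q.zero_le)).trans <|
      le_mul_of_one_le_left hε0 (Real.one_le_sqrt.2 (by exact_mod_cast hq))
  obtain ⟨hC₀, hpinv⟩ := isUnit_and_opNorm_transpose_mul_inv_le_of_close (by linarith) hC hCκ
    (hregressor.trans hε)
  refine ⟨hC₀, ?_⟩
  have hsqrt : 1 ≤ √κ := Real.one_le_sqrt.2 hκ
  have hκsq : κ ≤ κ ^ 2 := le_self_pow₀ hκ two_ne_zero
  rw [estimateA_sub (A := A) (B := B) C hC₀]
  calc _ ≤ (‖response q N - (A - B * K) * C‖ + ‖A - B * K‖ * ‖regressor q N - C‖) *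
          ‖(regressor q N)ᵀ * (regressor q N * (regressor q N)ᵀ)⁻¹‖ + ‖estimateB N - B‖ * ‖K‖ := by
        refine (norm_add_le _ _).trans (add_le_add ((Matrix.l2_opNorm_mul _ _).trans ?_)
          (Matrix.l2_opNorm_mul _ _))
        gcongr
        exact (norm_sub_le _ _).trans (add_le_add le_rfl (Matrix.l2_opNorm_mul _ _))
    _ ≤ (η + κ ^ 2 * η) * (2 * √κ) + η * κ := by
        gcongr
        exact hst.2.2.2.1
    _ ≤ (κ ^ 2 * η + κ ^ 2 * η) * (2 * √κ) + η * (√κ * κ ^ 2) := by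
        gcongr
        · exact le_mul_of_one_le_left hη0 (hκ.trans hκsq)
        · exact hκsq.trans (le_mul_of_one_le_left (sq_nonneg κ) hsqrt)
    _ = _ := by ring

end Estimates

section SingularValues

variable {E F : Type*} [NormedAddCommGroup E] [InnerProductSpace ℝ E] [FiniteDimensional ℝ E]
  [NormedAddCommGroup F] [InnerProductSpace ℝ F] [FiniteDimensional ℝ F]

theorem norm_sq_eq_sum_eigenvalues {n : ℕ} (hn : Module.finrank ℝ E = n) (T : E →ₗ[ℝ] F) (u : E) :
    ‖T u‖ ^ 2 = ∑ i, T.isSymmetric_adjoint_comp_self.eigenvalues hn i *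
      (T.isSymmetric_adjoint_comp_self.eigenvectorBasis hn).repr u i ^ 2 := by
  set b := T.isSymmetric_adjoint_comp_self.eigenvectorBasis hn
  calc ‖T u‖ ^ 2 = inner ℝ u ((LinearMap.adjoint T ∘ₗ T) u) := by
        rw [LinearMap.comp_apply, LinearMap.adjoint_inner_right, real_inner_self_eq_norm_sq]
    _ = inner ℝ (b.repr u) (b.repr ((LinearMap.adjoint T ∘ₗ T) u)) :=
        (b.repr.inner_map_map _ _).symm
    _ = _ := by
        rw [PiLp.inner_apply]
        refine Finset.sum_congr rfl fun i _ => ?_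
        rw [LinearMap.IsSymmetric.eigenvectorBasis_apply_self_apply]
        simp only [RCLike.inner_apply, conj_trivial, RCLike.ofReal_real_eq_id, id_eq]
        ring

theorem exists_finrank_le_norm_le_singularValues (T : E →ₗ[ℝ] F) (k : ℕ) :
    ∃ U : Submodule ℝ E, Module.finrank ℝ U ≤ k ∧ ∀ u ∈ Uᗮ, ‖T u‖ ≤ T.singularValues k * ‖u‖ := by
  rcases Nat.lt_or_ge k (Module.finrank ℝ E) with hk | hk
  swap
  · refine ⟨⊤, finrank_top ℝ E ▸ hk, fun u hu => ?_⟩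
    rw [Submodule.top_orthogonal_eq_bot, Submodule.mem_bot] at hu
    rw [hu, map_zero, norm_zero, norm_zero, mul_zero]
  have hS := T.isSymmetric_adjoint_comp_self
  set b := hS.eigenvectorBasis rfl
  refine ⟨Submodule.span ℝ (Set.range fun j : Fin k => b (j.castLE hk.le)),
    (finrank_range_le_card _).trans_eq (Fintype.card_fin k), fun u hu => ?_⟩
  have hlead : ∀ i : Fin (Module.finrank ℝ E), i < k → b.repr u i = 0 := fun i hi => by
    rw [b.repr_apply_apply]
    exact Submodule.mem_orthogonal _ _ |>.1 hu _ (Submodule.subset_span ⟨⟨i, hi⟩, rfl⟩)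
  refine le_of_sq_le_sq ?_ (mul_nonneg (T.singularValues_nonneg k) (norm_nonneg u))
  rw [mul_pow, T.sq_singularValues_of_lt rfl hk, norm_sq_eq_sum_eigenvalues rfl,
    ← b.repr.norm_map u, EuclideanSpace.real_norm_sq_eq, Finset.mul_sum]
  refine Finset.sum_le_sum fun i _ => ?_
  rcases Nat.lt_or_ge i k with hi | hi
  · simp only [b, hlead i hi, zero_pow two_ne_zero, mul_zero, le_refl]
  · exact mul_le_mul_of_nonneg_right (hS.eigenvalues_antitone rfl (Fin.le_def.2 hi)) (sq_nonneg _)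

variable {T : E →ₗ[ℝ] E} {e v : E}

theorem inner_map_eq_zero_of_contraction (hT : ∀ x, ‖T x‖ ≤ ‖x‖) (he : T e = e)
    (hev : inner ℝ e v = 0) : inner ℝ e (T v) = 0 := by
  have hadj : ‖LinearMap.adjoint T e‖ ≤ ‖e‖ := by
    have hsq : ‖LinearMap.adjoint T e‖ * ‖LinearMap.adjoint T e‖ ≤
        ‖LinearMap.adjoint T e‖ * ‖e‖ := by
      rw [← real_inner_self_eq_norm_mul_norm, LinearMap.adjoint_inner_right]
      exact (real_inner_le_norm _ _).trans (by gcongr; exact hT _)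
    rcases (norm_nonneg (LinearMap.adjoint T e)).eq_or_lt with h0 | hpos
    · exact h0 ▸ norm_nonneg e
    · exact le_of_mul_le_mul_left hsq hpos
  have hfix : LinearMap.adjoint T e = e := by
    have hsq : ‖LinearMap.adjoint T e - e‖ ^ 2 = ‖LinearMap.adjoint T e‖ ^ 2 - ‖e‖ ^ 2 := by
      rw [norm_sub_sq_real, LinearMap.adjoint_inner_left, he, real_inner_self_eq_norm_sq]
      ring
    have : ‖LinearMap.adjoint T e - e‖ ^ 2 ≤ 0 :=
      hsq.trans_le (sub_nonpos.2 (pow_le_pow_left₀ (norm_nonneg _) hadj 2))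
    rwa [sq_nonpos_iff, norm_eq_zero, sub_eq_zero] at this
  rw [← LinearMap.adjoint_inner_left, hfix, hev]

/-- The top singular value `1` is attained at `e`, so some `v - c e` avoids the leading right
singular vector; the component along `e` does not shrink and can be discarded. -/
theorem norm_map_le_singularValues_one_of_contraction (hT : ∀ x, ‖T x‖ ≤ ‖x‖) (he0 : e ≠ 0)
    (he : T e = e) (hev : inner ℝ e v = 0) : ‖T v‖ ≤ T.singularValues 1 * ‖v‖ := by
  have hσ0 := T.singularValues_nonneg 1
  set σ := T.singularValues 1
  rcases le_or_gt 1 σ with hσ | hσ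
  · exact (hT v).trans (le_mul_of_one_le_left (norm_nonneg v) hσ)
  obtain ⟨U, hU, hTU⟩ := exists_finrank_le_norm_le_singularValues T 1
  have heU : U.orthogonalProjectionOnto e ≠ 0 := fun h => by
    have := hTU e (Submodule.orthogonalProjectionOnto_eq_zero_iff.1 h)
    rw [he] at this
    nlinarith [norm_pos_iff.2 he0]
  obtain ⟨c, hc⟩ : ∃ c : ℝ, v - c • e ∈ Uᗮ := by
    have hU1 : Module.finrank ℝ U = 1 :=
      hU.antisymm (Module.finrank_pos_iff_exists_ne_zero.2 ⟨_, heU⟩)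
    obtain ⟨c, hc⟩ := exists_smul_eq_of_finrank_eq_one hU1 heU (U.orthogonalProjectionOnto v)
    exact ⟨c, Submodule.orthogonalProjectionOnto_eq_zero_iff.1 <| by
      rw [map_sub, map_smul, hc, sub_self]⟩
  have pyth : ∀ y : E, inner ℝ e y = 0 → ‖y - c • e‖ ^ 2 = ‖y‖ ^ 2 + c ^ 2 * ‖e‖ ^ 2 :=
    fun y hy => by
      rw [norm_sub_sq_real, real_inner_smul_right, real_inner_comm, hy, norm_smul, mul_pow,
        Real.norm_eq_abs, sq_abs]
      ring
  have hbound := pow_le_pow_left₀ (norm_nonneg _) (hTU _ hc) 2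
  rw [map_sub, map_smul, he, mul_pow, pyth _ hev,
    pyth _ (inner_map_eq_zero_of_contraction hT he hev)] at hbound
  refine le_of_sq_le_sq ?_ (by positivity)
  nlinarith [mul_nonneg (sq_nonneg c) (sq_nonneg ‖e‖), pow_le_one₀ hσ0 hσ.le (n := 2)]

end SingularValues

section Consensus

variable {m : ℕ} {P : Matrix (Fin m) (Fin m) ℝ}

theorem norm_mulVec_le_secondSingularValue (hP : P ∈ doublyStochastic ℝ (Fin m)) {v : Fin m → ℝ}
    (hv : ∑ j, v j = 0) :
    ‖WithLp.toLp 2 (P *ᵥ v)‖ ≤ secondSingularValue P * ‖WithLp.toLp 2 v‖ := by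
  rcases isEmpty_or_nonempty (Fin m) with _ | ⟨⟨i⟩⟩
  · simp only [Subsingleton.elim _ (0 : EuclideanSpace ℝ (Fin m)), norm_zero, mul_zero, le_refl]
  refine norm_map_le_singularValues_one_of_contraction (T := Matrix.toEuclideanLin P)
    (e := WithLp.toLp 2 1) (v := WithLp.toLp 2 v) (fun x => ?_) (fun h => ?_) ?_ ?_
  · exact (norm_mulVec_le P x.ofLp).trans (mul_le_of_le_one_left (norm_nonneg _)
      (Matrix.l2_opNorm_le_one_of_mem_doublyStochastic hP))
  · exact one_ne_zero (congrFun (congrArg WithLp.ofLp h) i)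
  · exact congrArg (WithLp.toLp 2) (mulVec_one_of_mem_doublyStochastic hP)
  · rw [EuclideanSpace.inner_toLp_toLp, star_one, dotProduct_one, hv]

theorem norm_pow_mulVec_le_secondSingularValue (hP : P ∈ doublyStochastic ℝ (Fin m))
    {v : Fin m → ℝ} (hv : ∑ j, v j = 0) (s : ℕ) :
    ‖WithLp.toLp 2 (P ^ s *ᵥ v)‖ ≤ secondSingularValue P ^ s * ‖WithLp.toLp 2 v‖ := by
  induction s with
  | zero => rw [pow_zero, pow_zero, Matrix.one_mulVec, one_mul]
  | succ s ih =>
    have hsum : ∑ j, (P ^ s *ᵥ v) j = 0 :=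
      (sum_mulVec_of_mem_doublyStochastic (pow_mem hP s)).trans hv
    rw [pow_succ', pow_succ', ← Matrix.mulVec_mulVec, mul_assoc]
    exact (norm_mulVec_le_secondSingularValue hP hsum).trans
      (mul_le_mul_of_nonneg_left ih (LinearMap.singularValues_nonneg _ _))

theorem norm_single_sub_mean_le (i : Fin m) :
    ‖WithLp.toLp 2 (Pi.single i 1 - (m : ℝ)⁻¹ • 1 : Fin m → ℝ)‖ ≤ 1 := by
  have hm : (0 : ℝ) < m := by exact_mod_cast i.pos
  have hsq : ∀ j, (Pi.single i 1 - (m : ℝ)⁻¹ • 1 : Fin m → ℝ) j ^ 2 =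
      (1 - 2 * (m : ℝ)⁻¹) * (Pi.single i (1 : ℝ) : Fin m → ℝ) j + (m : ℝ)⁻¹ ^ 2 := fun j => by
    simp only [Pi.sub_apply, Pi.smul_apply, Pi.one_apply, smul_eq_mul, Pi.single_apply]
    split_ifs <;> ring
  refine le_of_sq_le_sq ?_ zero_le_one
  calc _ = 1 - 2 * (m : ℝ)⁻¹ + m * (m : ℝ)⁻¹ ^ 2 := by
        rw [EuclideanSpace.real_norm_sq_eq]
        simp only [hsq, Finset.sum_add_distrib, ← Finset.mul_sum, Finset.sum_pi_single',
          Finset.mem_univ, if_true, mul_one, Finset.sum_const, Finset.card_univ, Fintype.card_fin,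
          nsmul_eq_mul]
    _ = 1 - (m : ℝ)⁻¹ := by field_simp; ring
    _ ≤ 1 ^ 2 := by linarith [inv_pos.2 hm]

theorem exchange_eq_sum_pow {d₁ d₂ : ℕ} (N : Fin m → Matrix (Fin d₁) (Fin d₂) ℝ) (s : ℕ)
    (i : Fin m) : exchange P N s i = ∑ j, (P ^ s) j i • N j := by
  induction s generalizing i with
  | zero =>
    simp only [exchange, pow_zero, Matrix.one_apply, ite_smul, one_smul, zero_smul,
      Finset.sum_ite_eq', Finset.mem_univ, if_true]
  | succ s ih =>
    simp only [exchange, ih, Finset.smul_sum, smul_smul]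
    rw [Finset.sum_comm]
    refine Finset.sum_congr rfl fun j _ => ?_
    rw [← Finset.sum_smul, pow_succ, Matrix.mul_apply]
    simp only [mul_comm]

theorem exchange_sub_mean_eq_sum (hP : P ∈ doublyStochastic ℝ (Fin m)) {d₁ d₂ : ℕ}
    (N : Fin m → Matrix (Fin d₁) (Fin d₂) ℝ) (s : ℕ) (i : Fin m) :
    exchange P N s i - (m : ℝ)⁻¹ • ∑ j, N j =
      ∑ j, (P ^ s *ᵥ (Pi.single i 1 - (m : ℝ)⁻¹ • 1)) j • N j := by
  rw [exchange_eq_sum_pow, Finset.smul_sum, ← Finset.sum_sub_distrib, Matrix.mulVec_sub,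
    Matrix.mulVec_smul, mulVec_one_of_mem_doublyStochastic (pow_mem hP s)]
  refine Finset.sum_congr rfl fun j _ => ?_
  rw [← sub_smul, Pi.sub_apply, Matrix.mulVec_single_one, Pi.smul_apply, Pi.one_apply, smul_eq_mul,
    mul_one, Matrix.col_apply]

theorem sum_abs_le_sqrt_card_mul_norm {ι : Type*} [Fintype ι] (u : ι → ℝ) :
    ∑ j, |u j| ≤ √(Fintype.card ι) * ‖WithLp.toLp 2 u‖ := by
  refine le_of_sq_le_sq ?_ (by positivity)
  rw [mul_pow, Real.sq_sqrt (Nat.cast_nonneg _), EuclideanSpace.norm_sq_eq]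
  exact sq_sum_le_card_mul_sum_sq

theorem norm_exchange_sub_mean_le (hP : P ∈ doublyStochastic ℝ (Fin m)) {d₁ d₂ : ℕ}
    {N : Fin m → Matrix (Fin d₁) (Fin d₂) ℝ} {R : ℝ} (hN : ∀ j, ‖entries (N j)‖ ≤ R) (s : ℕ)
    (i : Fin m) :
    ‖entries (exchange P N s i - (m : ℝ)⁻¹ • ∑ j, N j)‖ ≤
      √m * secondSingularValue P ^ s * R := by
  have hR : 0 ≤ R := (norm_nonneg _).trans (hN i)
  have hm : (m : ℝ) ≠ 0 := by exact_mod_cast i.pos.ne'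
  set v : Fin m → ℝ := Pi.single i 1 - (m : ℝ)⁻¹ • 1 with hv
  have hv0 : ∑ j, v j = 0 := by
    simp only [hv, Pi.sub_apply, Pi.smul_apply, Pi.one_apply, smul_eq_mul, mul_one,
      Finset.sum_sub_distrib, Finset.sum_pi_single', Finset.mem_univ, if_true, Finset.sum_const,
      Finset.card_univ, Fintype.card_fin, nsmul_eq_mul, mul_inv_cancel₀ hm, sub_self]
  have hdecay : ‖WithLp.toLp 2 (P ^ s *ᵥ v)‖ ≤ secondSingularValue P ^ s :=
    (norm_pow_mulVec_le_secondSingularValue hP hv0 s).trans <| mul_le_of_le_one_right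
      (pow_nonneg (LinearMap.singularValues_nonneg _ _) _) (norm_single_sub_mean_le i)
  rw [exchange_sub_mean_eq_sum hP, map_sum]
  calc ‖∑ j, entries ((P ^ s *ᵥ v) j • N j)‖ ≤ ∑ j, |(P ^ s *ᵥ v) j| * R := by
        refine norm_sum_le_of_le _ fun j _ => ?_
        rw [map_smul, norm_smul, Real.norm_eq_abs]
        exact mul_le_mul_of_nonneg_left (hN j) (abs_nonneg _)
    _ = (∑ j, |(P ^ s *ᵥ v) j|) * R := (Finset.sum_mul _ _ _).symm
    _ ≤ √m * secondSingularValue P ^ s * R := by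
        gcongr
        simpa only [Fintype.card_fin] using (sum_abs_le_sqrt_card_mul_norm (P ^ s *ᵥ v)).trans
          (mul_le_mul_of_nonneg_left hdecay (Real.sqrt_nonneg _))

end Consensus

section Trajectory

variable {d₁ d₂ : ℕ} {A : Matrix (Fin d₁) (Fin d₁) ℝ} {B : Matrix (Fin d₁) (Fin d₂) ℝ}
  {K : Matrix (Fin d₂) (Fin d₁) ℝ} {w : ℕ → Fin d₁ → ℝ} {ξ ξ' : ℕ → Fin d₂ → ℝ}

theorem explorationState_succ_eq_sum (A : Matrix (Fin d₁) (Fin d₁) ℝ)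
    (B : Matrix (Fin d₁) (Fin d₂) ℝ) (K : Matrix (Fin d₂) (Fin d₁) ℝ) (w : ℕ → Fin d₁ → ℝ)
    (ξ : ℕ → Fin d₂ → ℝ) (t : ℕ) :
    explorationState A B K w ξ (t + 1) =
      ∑ s ∈ Finset.Icc 1 t, (A - B * K) ^ (t - s) *ᵥ (B *ᵥ ξ s + w s) := by
  induction t with
  | zero => rfl
  | succ t ih =>
    have hstep : explorationState A B K w ξ (t + 1 + 1) =
        (A - B * K) *ᵥ explorationState A B K w ξ (t + 1) + (B *ᵥ ξ (t + 1) + w (t + 1)) := by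
      simp only [explorationState, explorationControl, Matrix.mulVec_add, Matrix.mulVec_neg,
        Matrix.sub_mulVec, Matrix.mulVec_mulVec]
      abel
    rw [hstep, ih, Finset.sum_Icc_succ_top (Nat.le_add_left 1 t), Matrix.mulVec_sum, Nat.sub_self,
      pow_zero, Matrix.one_mulVec]
    congr 1
    refine Finset.sum_congr rfl fun s hs => ?_
    rw [Matrix.mulVec_mulVec, ← pow_succ', Nat.succ_sub (Finset.mem_Icc.1 hs).2]

theorem explorationState_congr {t : ℕ} (h : ∀ s < t, ξ s = ξ' s) :
    explorationState A B K w ξ t = explorationState A B K w ξ' t := by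
  cases t with
  | zero => rfl
  | succ t =>
    rw [explorationState_succ_eq_sum, explorationState_succ_eq_sum]
    exact Finset.sum_congr rfl fun s hs => by
      rw [h s (Nat.lt_succ_of_le (Finset.mem_Icc.1 hs).2)]

theorem localMoment_congr {q Tc l : ℕ} (hl : l ≤ q) (h : ∀ s < Tc, ξ s = ξ' s) :
    localMoment q Tc (explorationState A B K w ξ) ξ l =
      localMoment q Tc (explorationState A B K w ξ') ξ' l := by
  rw [localMoment, localMoment]
  congr 1
  refine Finset.sum_congr rfl fun t ht => ?_
  rw [Finset.mem_Icc] at ht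
  rw [h t (by omega), explorationState_congr fun s hs => h s (by omega)]

theorem explorationState_succ_sub {s : ℕ} (h : ∀ t ≠ s, ξ' t = ξ t) (t : ℕ) :
    explorationState A B K w ξ' (t + 1) - explorationState A B K w ξ (t + 1) =
      if s ∈ Finset.Icc 1 t then ((A - B * K) ^ (t - s) * B) *ᵥ (ξ' s - ξ s) else 0 := by
  rw [explorationState_succ_eq_sum, explorationState_succ_eq_sum, ← Finset.sum_sub_distrib,
    ← Finset.sum_ite_eq' (Finset.Icc 1 t) s
      fun r => ((A - B * K) ^ (t - r) * B) *ᵥ (ξ' r - ξ r)]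
  refine Finset.sum_congr rfl fun r _ => ?_
  rw [← Matrix.mulVec_sub, add_sub_add_right_eq_sub, ← Matrix.mulVec_sub, Matrix.mulVec_mulVec]
  split_ifs with hr
  · rfl
  · rw [h r hr, sub_self, Matrix.mulVec_zero]

end Trajectory

section Influence

variable {γ : ℝ}

theorem sum_one_sub_pow_le_inv {ι : Type*} (hγ : 0 < γ) (hγ1 : γ ≤ 1) {I : Finset ι} {f : ι → ℕ}
    (hf : Set.InjOn f I) : ∑ i ∈ I, (1 - γ) ^ f i ≤ γ⁻¹ := by
  have h0 : 0 ≤ 1 - γ := sub_nonneg.2 hγ1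
  have h1 : 1 - γ < 1 := sub_lt_self 1 hγ
  calc ∑ i ∈ I, (1 - γ) ^ f i = ∑ k ∈ I.image f, (1 - γ) ^ k := (Finset.sum_image hf).symm
    _ ≤ ∑' k : ℕ, (1 - γ) ^ k :=
        (summable_geometric_of_lt_one h0 h1).sum_le_tsum _ fun k _ => pow_nonneg h0 k
    _ = γ⁻¹ := by rw [tsum_geometric_of_lt_one h0 h1, sub_sub_cancel]

/-- The normalized weight `γ ∑ₜ (1 - γ)^(t + l - s)` with which the signal at time `s` enters the
states at the times `t + l + 1`, `1 ≤ t ≤ n`. -/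
def influence (γ : ℝ) (n l s : ℕ) : ℝ :=
  γ * ∑ t ∈ Finset.Icc 1 n with s ∈ Finset.Icc 1 (t + l), (1 - γ) ^ (t + l - s)

theorem influence_nonneg (hγ : 0 < γ) (hγ1 : γ ≤ 1) (n l s : ℕ) : 0 ≤ influence γ n l s :=
  mul_nonneg hγ.le (Finset.sum_nonneg fun _ _ => pow_nonneg (sub_nonneg.2 hγ1) _)

theorem influence_le_one (hγ : 0 < γ) (hγ1 : γ ≤ 1) (n l s : ℕ) : influence γ n l s ≤ 1 := by
  rw [influence, ← le_div_iff₀' hγ, one_div]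
  refine sum_one_sub_pow_le_inv hγ hγ1 fun t ht t' ht' h => ?_
  simp only [Finset.coe_filter, Finset.mem_Icc, Set.mem_ofPred_eq] at ht ht' h
  omega

theorem sum_influence_le (hγ : 0 < γ) (hγ1 : γ ≤ 1) (n l : ℕ) (I : Finset ℕ) :
    ∑ s ∈ I, influence γ n l s ≤ n := by
  have hcol : ∀ t, γ * ∑ s ∈ I with s ∈ Finset.Icc 1 (t + l), (1 - γ) ^ (t + l - s) ≤ 1 :=
    fun t => by
      rw [← le_div_iff₀' hγ, one_div]
      refine sum_one_sub_pow_le_inv hγ hγ1 fun s hs s' hs' h => ?_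
      simp only [Finset.coe_filter, Finset.mem_Icc, Set.mem_ofPred_eq] at hs hs' h
      omega
  calc ∑ s ∈ I, influence γ n l s
      = ∑ t ∈ Finset.Icc 1 n,
          γ * ∑ s ∈ I with s ∈ Finset.Icc 1 (t + l), (1 - γ) ^ (t + l - s) := by
        simp only [influence, Finset.sum_filter, ← Finset.mul_sum]
        rw [Finset.sum_comm]
    _ ≤ ∑ _t ∈ Finset.Icc 1 n, (1 : ℝ) := Finset.sum_le_sum fun t _ => hcol t
    _ = n := by
        rw [Finset.sum_const, Nat.card_Icc, Nat.add_sub_cancel, nsmul_eq_mul, mul_one]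

/-- Bound for the change of `∑ₜ x_{t+l+1} ξₜᵀ`, `1 ≤ t ≤ n`, when only the signal at time `s`
changes and `M` bounds the size of the summands up to a factor `2`: the first term comes from the
later states, the second one from the factor `ξ_s`. -/
def momentVariation (M γ : ℝ) (n l s : ℕ) : ℝ :=
  2 * M * influence γ n l s + if s ∈ Finset.Icc 1 n then 4 * M else 0

theorem sum_momentVariation_sq_le (hγ : 0 < γ) (hγ1 : γ ≤ 1) (M : ℝ) (n l : ℕ) (I : Finset ℕ) :
    ∑ s ∈ I, momentVariation M γ n l s ^ 2 ≤ 40 * M ^ 2 * n := by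
  have hterm : ∀ s, momentVariation M γ n l s ^ 2 ≤
      8 * M ^ 2 * influence γ n l s + if s ∈ Finset.Icc 1 n then 32 * M ^ 2 else 0 := fun s => by
    have h0 := influence_nonneg hγ hγ1 n l s
    have hsq : M ^ 2 * influence γ n l s ^ 2 ≤ M ^ 2 * influence γ n l s :=
      mul_le_mul_of_nonneg_left (by nlinarith [influence_le_one hγ hγ1 n l s]) (sq_nonneg M)
    rw [momentVariation]
    split_ifs
    · nlinarith [sq_nonneg (M * (influence γ n l s - 2))]
    · nlinarith [mul_nonneg (sq_nonneg M) h0]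
  have hcard : ∑ s ∈ I, (if s ∈ Finset.Icc 1 n then 32 * M ^ 2 else 0) ≤ 32 * M ^ 2 * n := by
    rw [← Finset.sum_filter, Finset.sum_const, nsmul_eq_mul, mul_comm]
    gcongr
    calc _ ≤ (Finset.Icc 1 n).card := Finset.card_le_card fun s hs => (Finset.mem_filter.1 hs).2
      _ = n := by rw [Nat.card_Icc, Nat.add_sub_cancel]
  calc ∑ s ∈ I, momentVariation M γ n l s ^ 2
      ≤ 8 * M ^ 2 * ∑ s ∈ I, influence γ n l s +
          ∑ s ∈ I, if s ∈ Finset.Icc 1 n then 32 * M ^ 2 else 0 := by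
        rw [Finset.mul_sum, ← Finset.sum_add_distrib]
        exact Finset.sum_le_sum fun s _ => hterm s
    _ ≤ 8 * M ^ 2 * n + 32 * M ^ 2 * n := by
        gcongr
        exact sum_influence_le hγ hγ1 n l I
    _ = 40 * M ^ 2 * n := by ring

end Influence

section ClosedLoop

variable {d₁ d₂ : ℕ} {A : Matrix (Fin d₁) (Fin d₁) ℝ} {B : Matrix (Fin d₁) (Fin d₂) ℝ}
  {K : Matrix (Fin d₂) (Fin d₁) ℝ} {w : ℕ → Fin d₁ → ℝ} {κ γ W ρ : ℝ} {ξ ξ' : ℕ → Fin d₂ → ℝ}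

/-- The closed loop `A - B K` contracts at rate `1 - γ` up to the factor `κ²`, and `B` and the
disturbances are bounded. These bounds are all that the size of a trajectory depends on. -/
structure ClosedLoopBounds (A : Matrix (Fin d₁) (Fin d₁) ℝ) (B : Matrix (Fin d₁) (Fin d₂) ℝ)
    (K : Matrix (Fin d₂) (Fin d₁) ℝ) (w : ℕ → Fin d₁ → ℝ) (κ γ W : ℝ) : Prop where
  one_le_gain : 1 ≤ κ
  rate_pos : 0 < γ
  rate_le_one : γ ≤ 1
  one_le_disturbance : 1 ≤ W
  norm_pow_le : ∀ k, ‖(A - B * K) ^ k‖ ≤ κ ^ 2 * (1 - γ) ^ k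
  norm_input_le : ‖B‖ ≤ κ
  norm_disturbance_le : ∀ t, ‖WithLp.toLp 2 (w t)‖ ≤ W

/-- The scale `κ³ ρ² W / γ` of one term `x ξᵀ` of the moments, for signals of norm at most `ρ`. -/
noncomputable def momentScale (κ γ W ρ : ℝ) : ℝ := κ ^ 3 * ρ ^ 2 * W / γ

namespace ClosedLoopBounds

theorem norm_explorationState_le (h : ClosedLoopBounds A B K w κ γ W) (hρ : 1 ≤ ρ)
    (hξ : ∀ t, ‖WithLp.toLp 2 (ξ t)‖ ≤ ρ) (t : ℕ) :
    ‖WithLp.toLp 2 (explorationState A B K w ξ t)‖ ≤ 2 * κ ^ 3 * ρ * W / γ := by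
  obtain ⟨hκ, hγ, hγ1, hW, hdecay, hB, hw⟩ := h
  cases t with
  | zero =>
    rw [explorationState, WithLp.toLp_zero, norm_zero]
    positivity
  | succ t =>
    have hinput : ∀ s, ‖WithLp.toLp 2 (B *ᵥ ξ s + w s)‖ ≤ 2 * κ * ρ * W := fun s => by
      calc _ ≤ ‖WithLp.toLp 2 (B *ᵥ ξ s)‖ + ‖WithLp.toLp 2 (w s)‖ := norm_add_le _ _
        _ ≤ κ * ρ + W :=
          add_le_add ((norm_mulVec_le _ _).trans (by gcongr; exact hξ s)) (hw s)
        _ ≤ κ * ρ * W + κ * ρ * W := add_le_add (le_mul_of_one_le_right (by positivity) hW)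
          (le_mul_of_one_le_left (by positivity) (one_le_mul_of_one_le_of_one_le hκ hρ))
        _ = 2 * κ * ρ * W := by ring
    rw [explorationState_succ_eq_sum, WithLp.toLp_sum]
    calc _ ≤ ∑ s ∈ Finset.Icc 1 t, κ ^ 2 * (1 - γ) ^ (t - s) * (2 * κ * ρ * W) :=
          norm_sum_le_of_le _ fun s _ => (norm_mulVec_le _ _).trans <|
            mul_le_mul (hdecay _) (hinput s) (norm_nonneg _)
              ((norm_nonneg _).trans (hdecay _))
      _ = 2 * κ ^ 3 * ρ * W * ∑ s ∈ Finset.Icc 1 t, (1 - γ) ^ (t - s) := by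
          rw [Finset.mul_sum]
          exact Finset.sum_congr rfl fun s _ => by ring
      _ ≤ 2 * κ ^ 3 * ρ * W * γ⁻¹ := by
          gcongr
          refine sum_one_sub_pow_le_inv hγ hγ1 fun s hs s' hs' h => ?_
          simp only [Finset.coe_Icc, Set.mem_Icc] at hs hs' h
          omega
      _ = 2 * κ ^ 3 * ρ * W / γ := (div_eq_mul_inv _ _).symm

theorem norm_entries_vecMulVec_le (h : ClosedLoopBounds A B K w κ γ W) (hρ : 1 ≤ ρ)
    (hξ : ∀ t, ‖WithLp.toLp 2 (ξ t)‖ ≤ ρ) (t : ℕ) {v : Fin d₂ → ℝ} {r : ℝ}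
    (hv : ‖WithLp.toLp 2 v‖ ≤ r * ρ) :
    ‖entries (Matrix.vecMulVec (explorationState A B K w ξ t) v)‖ ≤
      2 * r * momentScale κ γ W ρ := by
  have hx := h.norm_explorationState_le hρ hξ t
  rw [norm_entries_vecMulVec]
  calc _ ≤ 2 * κ ^ 3 * ρ * W / γ * (r * ρ) :=
        mul_le_mul hx hv (norm_nonneg _) ((norm_nonneg _).trans hx)
    _ = _ := by rw [momentScale]; ring

theorem norm_explorationState_succ_sub_le (h : ClosedLoopBounds A B K w κ γ W)
    (hξ : ∀ t, ‖WithLp.toLp 2 (ξ t)‖ ≤ ρ) (hξ' : ∀ t, ‖WithLp.toLp 2 (ξ' t)‖ ≤ ρ) {s : ℕ}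
    (hs : ∀ t ≠ s, ξ' t = ξ t) (t : ℕ) :
    ‖WithLp.toLp 2 (explorationState A B K w ξ' (t + 1) - explorationState A B K w ξ (t + 1))‖ ≤
      if s ∈ Finset.Icc 1 t then 2 * κ ^ 3 * ρ * (1 - γ) ^ (t - s) else 0 := by
  obtain ⟨-, -, -, -, hdecay, hB, -⟩ := h
  rw [explorationState_succ_sub hs]
  split_ifs
  · have hgain : ‖(A - B * K) ^ (t - s) * B‖ ≤ κ ^ 2 * (1 - γ) ^ (t - s) * κ :=
      (Matrix.l2_opNorm_mul _ _).trans <|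
        mul_le_mul (hdecay _) hB (norm_nonneg _) ((norm_nonneg _).trans (hdecay _))
    have hjump : ‖WithLp.toLp 2 (ξ' s - ξ s)‖ ≤ ρ + ρ :=
      (norm_sub_le _ _).trans (add_le_add (hξ' s) (hξ s))
    calc _ ≤ κ ^ 2 * (1 - γ) ^ (t - s) * κ * (ρ + ρ) :=
          (norm_mulVec_le _ _).trans <|
            mul_le_mul hgain hjump (norm_nonneg _) ((norm_nonneg _).trans hgain)
      _ = _ := by ring
  · rw [WithLp.toLp_zero, norm_zero]

theorem norm_entries_vecMulVec_sub_le (h : ClosedLoopBounds A B K w κ γ W) (hρ : 1 ≤ ρ)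
    (hξ : ∀ t, ‖WithLp.toLp 2 (ξ t)‖ ≤ ρ) (hξ' : ∀ t, ‖WithLp.toLp 2 (ξ' t)‖ ≤ ρ) {s : ℕ}
    (hs : ∀ t ≠ s, ξ' t = ξ t) (l t : ℕ) :
    ‖entries (Matrix.vecMulVec (explorationState A B K w ξ' (t + l + 1)) (ξ' t) -
        Matrix.vecMulVec (explorationState A B K w ξ (t + l + 1)) (ξ t))‖ ≤
      (if s ∈ Finset.Icc 1 (t + l) then 2 * κ ^ 3 * ρ ^ 2 * (1 - γ) ^ (t + l - s) else 0) +
        if t = s then 4 * momentScale κ γ W ρ else 0 := by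
  have hsplit : ∀ x x' : Fin d₁ → ℝ, Matrix.vecMulVec x' (ξ' t) - Matrix.vecMulVec x (ξ t) =
      Matrix.vecMulVec (x' - x) (ξ' t) + Matrix.vecMulVec x (ξ' t - ξ t) := fun x x' => by
    rw [Matrix.sub_vecMulVec, Matrix.vecMulVec_sub]
    abel
  have hjump : ‖WithLp.toLp 2 (ξ' t - ξ t)‖ ≤ (if t = s then 2 else 0) * ρ := by
    split_ifs with hts
    · rw [two_mul]
      exact (norm_sub_le _ _).trans (add_le_add (hξ' t) (hξ t))
    · rw [hs t hts, sub_self, WithLp.toLp_zero, norm_zero, zero_mul]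
  have hstate := h.norm_explorationState_succ_sub_le hξ hξ' hs (t + l)
  rw [hsplit, map_add]
  refine (norm_add_le _ _).trans (add_le_add ?_ ?_)
  · rw [norm_entries_vecMulVec]
    refine (mul_le_mul hstate (hξ' t) (norm_nonneg _) ((norm_nonneg _).trans hstate)).trans_eq ?_
    rw [ite_mul, zero_mul]
    ring_nf
  · refine (h.norm_entries_vecMulVec_le hρ hξ _ hjump).trans_eq ?_
    split_ifs <;> ring

theorem norm_entries_sum_vecMulVec_sub_le (h : ClosedLoopBounds A B K w κ γ W) (hρ : 1 ≤ ρ)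
    (hξ : ∀ t, ‖WithLp.toLp 2 (ξ t)‖ ≤ ρ) (hξ' : ∀ t, ‖WithLp.toLp 2 (ξ' t)‖ ≤ ρ) {s : ℕ}
    (hs : ∀ t ≠ s, ξ' t = ξ t) (n l : ℕ) :
    ‖entries (∑ t ∈ Finset.Icc 1 n,
          Matrix.vecMulVec (explorationState A B K w ξ' (t + l + 1)) (ξ' t) -
        ∑ t ∈ Finset.Icc 1 n,
          Matrix.vecMulVec (explorationState A B K w ξ (t + l + 1)) (ξ t))‖ ≤
      momentVariation (momentScale κ γ W ρ) γ n l s := by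
  have hγ := h.rate_pos
  rw [← Finset.sum_sub_distrib, map_sum]
  refine (norm_sum_le_of_le _ fun t _ =>
    h.norm_entries_vecMulVec_sub_le hρ hξ hξ' hs l t).trans ?_
  rw [Finset.sum_add_distrib, Finset.sum_ite_eq', ← Finset.sum_filter, ← Finset.mul_sum,
    momentVariation]
  refine add_le_add ?_ le_rfl
  have hscale : 2 * κ ^ 3 * ρ ^ 2 * W = 2 * momentScale κ γ W ρ * γ := by
    rw [momentScale]
    field_simp
  have hweight : 0 ≤ ∑ t ∈ Finset.Icc 1 n with s ∈ Finset.Icc 1 (t + l), (1 - γ) ^ (t + l - s) :=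
    Finset.sum_nonneg fun _ _ => pow_nonneg (sub_nonneg.2 h.rate_le_one) _
  rw [influence, ← mul_assoc, ← hscale]
  have hκ := h.one_le_gain
  exact mul_le_mul_of_nonneg_right (le_mul_of_one_le_right (by positivity) h.one_le_disturbance)
    hweight

theorem norm_entries_localMoment_le (h : ClosedLoopBounds A B K w κ γ W) (hρ : 1 ≤ ρ)
    (hξ : ∀ t, ‖WithLp.toLp 2 (ξ t)‖ ≤ ρ) {q Tc : ℕ} (hT : q + 1 < Tc) (l : ℕ) :
    ‖entries (localMoment q Tc (explorationState A B K w ξ) ξ l)‖ ≤ 2 * momentScale κ γ W ρ := by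
  have hn : ((Tc - (q + 1) : ℕ) : ℝ) = (Tc : ℝ) - ((q : ℝ) + 1) := by
    rw [Nat.cast_sub hT.le, Nat.cast_add, Nat.cast_one]
  have hn0 : (0 : ℝ) < (Tc - (q + 1) : ℕ) := by exact_mod_cast Nat.sub_pos_of_lt hT
  have hterm : ∀ t, ‖entries (Matrix.vecMulVec (explorationState A B K w ξ (t + l + 1)) (ξ t))‖ ≤
      2 * momentScale κ γ W ρ := fun t => by
    simpa only [mul_one] using h.norm_entries_vecMulVec_le hρ hξ (t + l + 1) (r := 1)
      ((hξ t).trans_eq (one_mul ρ).symm)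
  rw [localMoment, ← hn, one_div, map_smul, norm_smul, Real.norm_of_nonneg (by positivity),
    inv_mul_le_iff₀ hn0, map_sum]
  refine (norm_sum_le_of_le _ fun t _ => hterm t).trans_eq ?_
  rw [Finset.sum_const, Nat.card_Icc, nsmul_eq_mul, Nat.add_sub_cancel]

end ClosedLoopBounds

end ClosedLoop

section SignCube

variable {d : ℕ}

theorem measurePreserving_uniformOn {α : Type*} [MeasurableSpace α] (σ : α ≃ᵐ α) {s : Set α}
    (hs : MeasurableSet s) (hσ : σ ⁻¹' s = s) :
    MeasurePreserving σ (uniformOn s) (uniformOn s) := by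
  have hcount : MeasurePreserving σ (Measure.count : Measure α) Measure.count :=
    ⟨σ.measurable, Measure.ext fun t ht => by
      rw [σ.map_apply, Measure.count_apply (σ.measurable ht), Measure.count_apply ht,
        Set.encard_preimage_of_bijective σ.bijective]⟩
  have hrestrict := hcount.restrict_preimage hs
  rw [hσ] at hrestrict
  exact hrestrict.smul_measure _

theorem integral_eq_zero_of_comp_eq_neg {α : Type*} [MeasurableSpace α] {ν : Measure α}
    {σ : α ≃ᵐ α} (hσ : MeasurePreserving σ ν ν) {f : α → ℝ} (hf : ∀ x, f (σ x) = -f x) :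
    ∫ x, f x ∂ν = 0 := by
  have h := hσ.integral_comp' f
  rw [integral_congr_ae (Filter.Eventually.of_forall hf), integral_neg] at h
  exact self_eq_neg.1 h.symm

/-- The reflection `v_a ↦ -v_a` in the coordinate hyperplane `v_a = 0`. -/
noncomputable def coordinateFlip (a : Fin d) : (Fin d → ℝ) ≃ᵐ (Fin d → ℝ) :=
  MeasurableEquiv.piCongrRight fun b => if b = a then MeasurableEquiv.neg ℝ else .refl ℝ

theorem coordinateFlip_apply (a b : Fin d) (v : Fin d → ℝ) :
    coordinateFlip a v b = if b = a then -v b else v b := by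
  change (if b = a then MeasurableEquiv.neg ℝ else .refl ℝ) (v b) = _
  split_ifs <;> rfl

theorem finite_signCube (d : ℕ) : (signCube d).Finite := by
  have hpi : signCube d = Set.univ.pi fun _ => {1, -1} := by
    ext v
    simp only [signCube, Set.mem_ofPred_eq, Set.mem_univ_pi, Set.mem_insert_iff,
      Set.mem_singleton_iff]
  rw [hpi]
  exact Set.Finite.pi fun _ => Set.toFinite _

theorem isProbabilityMeasure_uniformOn_signCube (d : ℕ) :
    IsProbabilityMeasure (uniformOn (signCube d)) :=
  isProbabilityMeasure_uniformOn (finite_signCube d) ⟨1, fun _ => .inl rfl⟩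

theorem ae_mem_signCube (d : ℕ) : ∀ᵐ v ∂uniformOn (signCube d), v ∈ signCube d :=
  ae_cond_mem (finite_signCube d).measurableSet

theorem sq_eq_one_of_mem_signCube {v : Fin d → ℝ} (hv : v ∈ signCube d) (a : Fin d) :
    v a ^ 2 = 1 :=
  sq_eq_one_iff.2 (hv a)

theorem norm_toLp_of_mem_signCube {v : Fin d → ℝ} (hv : v ∈ signCube d) :
    ‖WithLp.toLp 2 v‖ = √d := by
  simp only [EuclideanSpace.norm_eq, Real.norm_eq_abs, sq_abs, sq_eq_one_of_mem_signCube hv,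
    Finset.sum_const, Finset.card_univ, Fintype.card_fin, nsmul_eq_mul, mul_one]

theorem measurePreserving_coordinateFlip (a : Fin d) :
    MeasurePreserving (coordinateFlip a) (uniformOn (signCube d)) (uniformOn (signCube d)) := by
  refine measurePreserving_uniformOn _ (finite_signCube d).measurableSet ?_
  ext v
  refine forall_congr' fun b => ?_
  rw [coordinateFlip_apply]
  split_ifs
  · rw [neg_eq_iff_eq_neg, neg_inj, or_comm]
  · rfl

theorem integral_uniformOn_signCube_apply (a : Fin d) :
    ∫ v, v a ∂uniformOn (signCube d) = 0 :=
  integral_eq_zero_of_comp_eq_neg (measurePreserving_coordinateFlip a) fun v => by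
    rw [coordinateFlip_apply, if_pos rfl]

theorem integral_uniformOn_signCube_mul (a b : Fin d) :
    ∫ v, v a * v b ∂uniformOn (signCube d) = (1 : Matrix (Fin d) (Fin d) ℝ) a b := by
  have := isProbabilityMeasure_uniformOn_signCube d
  rw [Matrix.one_apply]
  split_ifs with hab
  · have hone : (fun v => v a * v b) =ᵐ[uniformOn (signCube d)] fun _ => (1 : ℝ) := by
      filter_upwards [ae_mem_signCube d] with v hv
      rw [← hab, ← sq, sq_eq_one_of_mem_signCube hv]
    rw [integral_congr_ae hone, integral_const, probReal_univ, one_smul]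
  · exact integral_eq_zero_of_comp_eq_neg (measurePreserving_coordinateFlip a) fun v => by
      rw [coordinateFlip_apply, coordinateFlip_apply, if_pos rfl, if_neg (Ne.symm hab), neg_mul]

end SignCube

section Noise

variable {m d : ℕ} {Ω : Type*} [MeasurableSpace Ω] {μ : Measure Ω} {ξ : Fin m → ℕ → Ω → Fin d → ℝ}

/-- The properties of the exploration noise that the analysis uses: signals that are independent
over all pairs `(i, t)`, have mean zero and covariance the identity matrix, and are almost surely
of norm at most `√d`. -/
structure IsIsotropicNoise (μ : Measure Ω) (ξ : Fin m → ℕ → Ω → Fin d → ℝ) : Prop where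
  measurable : ∀ i t, Measurable (ξ i t)
  indep : iIndepFun (fun p : Fin m × ℕ => ξ p.1 p.2) μ
  mean : ∀ i t a, ∫ ω, ξ i t ω a ∂μ = 0
  covariance : ∀ i t a b, ∫ ω, ξ i t ω a * ξ i t ω b ∂μ = (1 : Matrix (Fin d) (Fin d) ℝ) a b
  norm_le : ∀ i t, ∀ᵐ ω ∂μ, ‖WithLp.toLp 2 (ξ i t ω)‖ ≤ √d

theorem IsExplorationNoise.isIsotropicNoise (h : IsExplorationNoise μ ξ) :
    IsIsotropicNoise μ ξ := by
  have hlaw : ∀ i t (f : (Fin d → ℝ) → ℝ), Measurable f →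
      ∫ ω, f (ξ i t ω) ∂μ = ∫ v, f v ∂uniformOn (signCube d) := fun i t f hf => by
    rw [← h.law i t, integral_map (h.measurable i t).aemeasurable hf.aestronglyMeasurable]
  refine ⟨h.measurable, h.indep, fun i t a => ?_, fun i t a b => ?_, fun i t => ?_⟩
  · rw [hlaw i t (fun v => v a) (by fun_prop), integral_uniformOn_signCube_apply]
  · rw [hlaw i t (fun v => v a * v b) (by fun_prop), integral_uniformOn_signCube_mul]
  · have hmem : ∀ᵐ v ∂μ.map (ξ i t), v ∈ signCube d := by
      rw [h.law]
      exact ae_mem_signCube d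
    filter_upwards [ae_of_ae_map (h.measurable i t).aemeasurable hmem] with ω hω
    exact (norm_toLp_of_mem_signCube hω).le

namespace IsIsotropicNoise

theorem memLp_apply [IsFiniteMeasure μ] (h : IsIsotropicNoise μ ξ) (p : ENNReal) (i : Fin m) (t : ℕ)
    (a : Fin d) : MemLp (fun ω => ξ i t ω a) p μ := by
  refine MemLp.of_bound ((measurable_pi_apply a).comp (h.measurable i t)).aestronglyMeasurable √d ?_
  filter_upwards [h.norm_le i t] with ω hω
  exact (PiLp.norm_apply_le (WithLp.toLp 2 (ξ i t ω)) a).trans hω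

theorem integrable_apply [IsFiniteMeasure μ] (h : IsIsotropicNoise μ ξ) (i : Fin m) (t : ℕ)
    (a : Fin d) : Integrable (fun ω => ξ i t ω a) μ :=
  (h.memLp_apply 1 i t a).integrable le_rfl

theorem integrable_mul [IsFiniteMeasure μ] (h : IsIsotropicNoise μ ξ) (i : Fin m) (s t : ℕ)
    (a b : Fin d) : Integrable (fun ω => ξ i s ω a * ξ i t ω b) μ :=
  (h.memLp_apply 2 i s a).integrable_mul (h.memLp_apply 2 i t b)

theorem integral_mul (h : IsIsotropicNoise μ ξ) (i : Fin m) (s t : ℕ) (a b : Fin d) :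
    ∫ ω, ξ i s ω a * ξ i t ω b ∂μ =
      if s = t then (1 : Matrix (Fin d) (Fin d) ℝ) a b else 0 := by
  split_ifs with hst
  · rw [hst, h.covariance]
  · have hne : (i, s) ≠ (i, t) := fun heq => hst (Prod.mk.inj heq).2
    have hindep : IndepFun (fun ω => ξ i s ω a) (fun ω => ξ i t ω b) μ :=
      (h.indep.indepFun hne).comp (measurable_pi_apply a) (measurable_pi_apply b)
    rw [hindep.integral_fun_mul_eq_mul_integral
      ((measurable_pi_apply a).comp (h.measurable i s)).aestronglyMeasurable
      ((measurable_pi_apply b).comp (h.measurable i t)).aestronglyMeasurable, h.mean, zero_mul]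

end IsIsotropicNoise

end Noise

section Expectation

variable {m d₁ d₂ : ℕ} {Ω : Type*} [MeasurableSpace Ω] {μ : Measure Ω} [IsProbabilityMeasure μ]
  {ξ : Fin m → ℕ → Ω → Fin d₂ → ℝ}

theorem explorationState_succ_apply_mul (A : Matrix (Fin d₁) (Fin d₁) ℝ)
    (B : Matrix (Fin d₁) (Fin d₂) ℝ) (K : Matrix (Fin d₂) (Fin d₁) ℝ) (w : ℕ → Fin d₁ → ℝ)
    (ξ : ℕ → Fin d₂ → ℝ) (t : ℕ) (a : Fin d₁) (y : ℝ) :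
    explorationState A B K w ξ (t + 1) a * y =
      ∑ s ∈ Finset.Icc 1 t, (∑ c, ((A - B * K) ^ (t - s) * B) a c * (ξ s c * y) +
        ((A - B * K) ^ (t - s) *ᵥ w s) a * y) := by
  rw [explorationState_succ_eq_sum, Finset.sum_apply, Finset.sum_mul]
  refine Finset.sum_congr rfl fun s _ => ?_
  rw [Matrix.mulVec_add, Matrix.mulVec_mulVec, Pi.add_apply, add_mul, Matrix.mulVec, dotProduct,
    Finset.sum_mul]
  simp only [mul_assoc]

/-- The moments averaged over all agents, for given signals. -/
noncomputable def meanMoment (A : Matrix (Fin d₁) (Fin d₁) ℝ) (B : Matrix (Fin d₁) (Fin d₂) ℝ)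
    (K : Matrix (Fin d₂) (Fin d₁) ℝ) (w : ℕ → Fin d₁ → ℝ) (q Tc : ℕ) (ξ : Fin m → ℕ → Fin d₂ → ℝ)
    (l : ℕ) : Matrix (Fin d₁) (Fin d₂) ℝ :=
  (m : ℝ)⁻¹ • ∑ j, localMoment q Tc (explorationState A B K w (ξ j)) (ξ j) l

namespace IsIsotropicNoise

variable (A : Matrix (Fin d₁) (Fin d₁) ℝ) (B : Matrix (Fin d₁) (Fin d₂) ℝ)
  (K : Matrix (Fin d₂) (Fin d₁) ℝ) (w : ℕ → Fin d₁ → ℝ)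

theorem integrable_explorationState_mul (h : IsIsotropicNoise μ ξ) (i : Fin m) (t s : ℕ)
    (a : Fin d₁) (b : Fin d₂) :
    Integrable (fun ω => explorationState A B K w (fun r => ξ i r ω) (t + 1) a * ξ i s ω b) μ := by
  simp only [explorationState_succ_apply_mul]
  exact integrable_finsetSum _ fun r _ =>
    (integrable_finsetSum _ fun c _ => (h.integrable_mul i r s c b).const_mul _).add
      ((h.integrable_apply i s b).const_mul _)

theorem integral_explorationState_mul (h : IsIsotropicNoise μ ξ) (i : Fin m) {t s : ℕ}
    (hs : s ∈ Finset.Icc 1 t) (a : Fin d₁) (b : Fin d₂) :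
    ∫ ω, explorationState A B K w (fun r => ξ i r ω) (t + 1) a * ξ i s ω b ∂μ =
      ((A - B * K) ^ (t - s) * B) a b := by
  have hquad : ∀ r c, Integrable
      (fun ω => ((A - B * K) ^ (t - r) * B) a c * (ξ i r ω c * ξ i s ω b)) μ :=
    fun r c => (h.integrable_mul i r s c b).const_mul _
  have hlin : ∀ r, Integrable (fun ω => ((A - B * K) ^ (t - r) *ᵥ w r) a * ξ i s ω b) μ :=
    fun r => (h.integrable_apply i s b).const_mul _
  have hsum : ∀ r, Integrable (fun ω => ∑ c, ((A - B * K) ^ (t - r) * B) a c *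
      (ξ i r ω c * ξ i s ω b) + ((A - B * K) ^ (t - r) *ᵥ w r) a * ξ i s ω b) μ :=
    fun r => (integrable_finsetSum _ fun c _ => hquad r c).add (hlin r)
  have hterm : ∀ r, ∫ ω, (∑ c, ((A - B * K) ^ (t - r) * B) a c * (ξ i r ω c * ξ i s ω b) +
        ((A - B * K) ^ (t - r) *ᵥ w r) a * ξ i s ω b) ∂μ =
      if s = r then ((A - B * K) ^ (t - r) * B) a b else 0 := fun r => by
    rw [integral_add (integrable_finsetSum _ fun c _ => hquad r c) (hlin r), integral_const_mul,
      h.mean, mul_zero, add_zero, integral_finsetSum _ fun c _ => hquad r c]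
    simp only [integral_const_mul, h.integral_mul, eq_comm (a := s)]
    split_ifs
    · simp only [Matrix.one_apply, mul_ite, mul_one, mul_zero, Finset.sum_ite_eq',
        Finset.mem_univ, if_true]
    · simp only [mul_zero, Finset.sum_const_zero]
  simp only [explorationState_succ_apply_mul]
  rw [integral_finsetSum _ fun r _ => hsum r]
  simp only [hterm, Finset.sum_ite_eq, if_pos hs]

theorem integrable_localMoment_apply (h : IsIsotropicNoise μ ξ) (i : Fin m) (q Tc l : ℕ)
    (a : Fin d₁) (b : Fin d₂) :
    Integrable (fun ω => localMoment q Tc (explorationState A B K w fun t => ξ i t ω)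
      (fun t => ξ i t ω) l a b) μ := by
  simp only [localMoment, Matrix.smul_apply, Matrix.sum_apply, Matrix.vecMulVec_apply, smul_eq_mul]
  exact (integrable_finsetSum _ fun t _ =>
    h.integrable_explorationState_mul A B K w i (t + l) t a b).const_mul _

theorem integral_localMoment_apply (h : IsIsotropicNoise μ ξ) (i : Fin m) {q Tc : ℕ}
    (hT : q + 1 < Tc) (l : ℕ) (a : Fin d₁) (b : Fin d₂) :
    ∫ ω, localMoment q Tc (explorationState A B K w fun t => ξ i t ω) (fun t => ξ i t ω) l a b ∂μ =
      ((A - B * K) ^ l * B) a b := by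
  have hn : ((Tc - (q + 1) : ℕ) : ℝ) = (Tc : ℝ) - ((q : ℝ) + 1) := by
    rw [Nat.cast_sub hT.le, Nat.cast_add, Nat.cast_one]
  have hn0 : ((Tc - (q + 1) : ℕ) : ℝ) ≠ 0 := Nat.cast_ne_zero.2 (Nat.sub_ne_zero_of_lt hT)
  have hterm : ∀ t ∈ Finset.Icc 1 (Tc - (q + 1)),
      ∫ ω, explorationState A B K w (fun r => ξ i r ω) (t + l + 1) a * ξ i t ω b ∂μ =
        ((A - B * K) ^ l * B) a b := fun t ht => by
    have ht' : t ∈ Finset.Icc 1 (t + l) :=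
      Finset.mem_Icc.2 ⟨(Finset.mem_Icc.1 ht).1, Nat.le_add_right t l⟩
    rw [h.integral_explorationState_mul A B K w i ht', Nat.add_sub_cancel_left]
  simp only [localMoment, Matrix.smul_apply, Matrix.sum_apply, Matrix.vecMulVec_apply, ← hn,
    smul_eq_mul]
  rw [integral_const_mul, integral_finsetSum _ fun t _ =>
    h.integrable_explorationState_mul A B K w i (t + l) t a b, Finset.sum_congr rfl hterm,
    Finset.sum_const, Nat.card_Icc, Nat.add_sub_cancel, nsmul_eq_mul, one_div,
    inv_mul_cancel_left₀ hn0]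

theorem integral_entries_meanMoment (h : IsIsotropicNoise μ ξ) (hm : 0 < m) {q Tc : ℕ}
    (hT : q + 1 < Tc) (l : ℕ) :
    ∫ ω, entries (meanMoment A B K w q Tc (fun i t => ξ i t ω) l) ∂μ =
      entries ((A - B * K) ^ l * B) := by
  have hm0 : (m : ℝ) ≠ 0 := Nat.cast_ne_zero.2 hm.ne'
  have hint := fun i => h.integrable_localMoment_apply A B K w i q Tc l
  ext ⟨a, b⟩
  have hentry : ∀ ω, entries (meanMoment A B K w q Tc (fun i t => ξ i t ω) l) (a, b) =
      (m : ℝ)⁻¹ * ∑ i, localMoment q Tc (explorationState A B K w fun t => ξ i t ω)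
        (fun t => ξ i t ω) l a b := fun ω => by
    rw [entries_apply, meanMoment, Matrix.smul_apply, Matrix.sum_apply, smul_eq_mul]
  rw [eval_integral_piLp]
  · simp only [hentry]
    rw [integral_const_mul, integral_finsetSum _ fun i _ => hint i a b]
    simp only [h.integral_localMoment_apply A B K w _ hT, Finset.sum_const, Finset.card_univ,
      Fintype.card_fin, nsmul_eq_mul]
    exact inv_mul_cancel_left₀ hm0 _
  · rintro ⟨a', b'⟩
    simp only [entries_apply, meanMoment, Matrix.smul_apply, Matrix.sum_apply, smul_eq_mul]
    exact (integrable_finsetSum _ fun i _ => hint i a' b').const_mul _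

end IsIsotropicNoise

end Expectation

section Concentration

variable {m d₁ d₂ q Tc : ℕ} {A : Matrix (Fin d₁) (Fin d₁) ℝ} {B : Matrix (Fin d₁) (Fin d₂) ℝ}
  {K : Matrix (Fin d₂) (Fin d₁) ℝ} {w : ℕ → Fin d₁ → ℝ} {κ γ W ρ : ℝ}

theorem continuous_explorationState (A : Matrix (Fin d₁) (Fin d₁) ℝ)
    (B : Matrix (Fin d₁) (Fin d₂) ℝ) (K : Matrix (Fin d₂) (Fin d₁) ℝ) (w : ℕ → Fin d₁ → ℝ) :
    ∀ t, Continuous fun ξ : ℕ → Fin d₂ → ℝ => explorationState A B K w ξ t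
  | 0 => continuous_const
  | t + 1 => by
    simp only [explorationState_succ_eq_sum]
    fun_prop

theorem continuous_entries_meanMoment (A : Matrix (Fin d₁) (Fin d₁) ℝ)
    (B : Matrix (Fin d₁) (Fin d₂) ℝ) (K : Matrix (Fin d₂) (Fin d₁) ℝ) (w : ℕ → Fin d₁ → ℝ)
    (q Tc l : ℕ) : Continuous fun z : Fin m × ℕ → Fin d₂ → ℝ =>
      entries (meanMoment A B K w q Tc (fun i t => z (i, t)) l) := by
  have hstate : ∀ (i : Fin m) (t : ℕ) (a : Fin d₁), Continuous fun z : Fin m × ℕ → Fin d₂ → ℝ =>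
      explorationState A B K w (fun s => z (i, s)) t a := fun i t a =>
    (continuous_apply a).comp ((continuous_explorationState A B K w t).comp (by fun_prop))
  refine (PiLp.continuous_toLp 2 _).comp (continuous_pi fun p => ?_)
  simp only [meanMoment, localMoment, Matrix.smul_apply, Matrix.sum_apply, Matrix.vecMulVec_apply]
  fun_prop

theorem dependsOn_entries_meanMoment (A : Matrix (Fin d₁) (Fin d₁) ℝ)
    (B : Matrix (Fin d₁) (Fin d₂) ℝ) (K : Matrix (Fin d₂) (Fin d₁) ℝ) (w : ℕ → Fin d₁ → ℝ)
    {l : ℕ} (hl : l ≤ q) :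
    DependsOn (fun z : Fin m × ℕ → Fin d₂ → ℝ =>
      entries (meanMoment A B K w q Tc (fun i t => z (i, t)) l))
      (Finset.univ ×ˢ Finset.range Tc : Finset (Fin m × ℕ)) := by
  intro z z' h
  refine congrArg (fun M => entries ((m : ℝ)⁻¹ • M)) (Finset.sum_congr rfl fun i _ => ?_)
  refine localMoment_congr hl fun t ht => h (i, t) ?_
  exact Finset.mem_product.2 ⟨Finset.mem_univ i, Finset.mem_range.2 ht⟩

theorem sampleSize_pos (hm : 0 < m) (hT : q + 1 < Tc) : 0 < sampleSize m q Tc :=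
  mul_pos (Nat.cast_pos.2 hm) (sub_pos.2 (by exact_mod_cast hT))

theorem sum_inv_sampleSize_mul_momentVariation_sq_le (hγ : 0 < γ) (hγ1 : γ ≤ 1) (M : ℝ)
    (hm : 0 < m) (hT : q + 1 < Tc) (l : ℕ) :
    ∑ p ∈ (Finset.univ ×ˢ Finset.range Tc : Finset (Fin m × ℕ)),
      ((sampleSize m q Tc)⁻¹ * momentVariation M γ (Tc - (q + 1)) l p.2) ^ 2 ≤
        40 * M ^ 2 / sampleSize m q Tc := by
  have hS := sampleSize_pos hm hT
  have hagent := sum_momentVariation_sq_le hγ hγ1 M (Tc - (q + 1)) l (Finset.range Tc)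
  rw [Nat.cast_sub hT.le, Nat.cast_add, Nat.cast_one] at hagent
  simp only [Finset.sum_product, mul_pow, ← Finset.mul_sum, Finset.sum_const, Finset.card_univ,
    Fintype.card_fin, nsmul_eq_mul]
  calc _ ≤ (sampleSize m q Tc)⁻¹ ^ 2 * ((m : ℝ) *
        (40 * M ^ 2 * ((Tc : ℝ) - ((q : ℝ) + 1)))) := by gcongr
    _ = (sampleSize m q Tc)⁻¹ ^ 2 * (40 * M ^ 2 * sampleSize m q Tc) := by rw [sampleSize]; ring
    _ = _ := by field_simp

theorem meanMoment_sub_meanMoment_of_forall_ne {ξ ξ' : Fin m → ℕ → Fin d₂ → ℝ} {i : Fin m}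
    (h : ∀ j ≠ i, ξ' j = ξ j) (l : ℕ) :
    meanMoment A B K w q Tc ξ' l - meanMoment A B K w q Tc ξ l = (sampleSize m q Tc)⁻¹ •
      (∑ t ∈ Finset.Icc 1 (Tc - (q + 1)),
          Matrix.vecMulVec (explorationState A B K w (ξ' i) (t + l + 1)) (ξ' i t) -
        ∑ t ∈ Finset.Icc 1 (Tc - (q + 1)),
          Matrix.vecMulVec (explorationState A B K w (ξ i) (t + l + 1)) (ξ i t)) := by
  rw [meanMoment, meanMoment, ← smul_sub, ← Finset.sum_sub_distrib,
    Finset.sum_eq_single i (fun j _ hj => by rw [h j hj, sub_self])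
      (fun hi => (hi (Finset.mem_univ i)).elim),
    localMoment, localMoment, ← smul_sub, smul_smul, sampleSize, mul_inv, one_div]

namespace ClosedLoopBounds

theorem momentScale_pos (h : ClosedLoopBounds A B K w κ γ W) (hρ : 0 < ρ) :
    0 < momentScale κ γ W ρ := by
  have hκ := zero_lt_one.trans_le h.one_le_gain
  have hW := zero_lt_one.trans_le h.one_le_disturbance
  have hγ := h.rate_pos
  rw [momentScale]
  positivity

theorem norm_entries_meanMoment_sub_le (h : ClosedLoopBounds A B K w κ γ W) (hρ : 1 ≤ ρ)
    {z z' : Fin m × ℕ → Fin d₂ → ℝ} (hz : ∀ p, ‖WithLp.toLp 2 (z p)‖ ≤ ρ)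
    (hz' : ∀ p, ‖WithLp.toLp 2 (z' p)‖ ≤ ρ) {p : Fin m × ℕ} (hp : ∀ p' ≠ p, z' p' = z p')
    (hm : 0 < m) (hT : q + 1 < Tc) (l : ℕ) :
    ‖entries (meanMoment A B K w q Tc (fun i t => z' (i, t)) l) -
        entries (meanMoment A B K w q Tc (fun i t => z (i, t)) l)‖ ≤
      (sampleSize m q Tc)⁻¹ * momentVariation (momentScale κ γ W ρ) γ (Tc - (q + 1)) l p.2 := by
  have hS : 0 ≤ (sampleSize m q Tc)⁻¹ := (inv_pos.2 (sampleSize_pos hm hT)).le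
  have hagent : ∀ j ≠ p.1, (fun t => z' (j, t)) = fun t => z (j, t) := fun j hj =>
    funext fun t => hp (j, t) fun heq => hj (congrArg Prod.fst heq)
  have htime : ∀ t ≠ p.2, z' (p.1, t) = z (p.1, t) := fun t ht =>
    hp (p.1, t) fun heq => ht (congrArg Prod.snd heq)
  rw [← map_sub, meanMoment_sub_meanMoment_of_forall_ne hagent, map_smul, norm_smul,
    Real.norm_of_nonneg hS]
  exact mul_le_mul_of_nonneg_left (h.norm_entries_sum_vecMulVec_sub_le hρ (fun t => hz (p.1, t))
    (fun t => hz' (p.1, t)) htime _ l) hS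

variable {Ω : Type*} [MeasurableSpace Ω] {μ : Measure Ω} [IsProbabilityMeasure μ]
  {ξ : Fin m → ℕ → Ω → Fin d₂ → ℝ}

theorem measureReal_le_norm_entries_meanMoment_sub_le (h : ClosedLoopBounds A B K w κ γ W)
    (hξ : IsIsotropicNoise μ ξ) (hm : 0 < m) (hd₂ : 0 < d₂) (hT : q + 1 < Tc) {l : ℕ} (hl : l ≤ q)
    {r : ℝ} (hr : 0 ≤ r) :
    μ.real {ω | r ≤ ‖entries (meanMoment A B K w q Tc (fun i t => ξ i t ω) l) -
        entries ((A - B * K) ^ l * B)‖} ≤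
      2 * Real.exp (-(r ^ 2 / (2 * (40 * momentScale κ γ W √d₂ ^ 2 / sampleSize m q Tc)))) := by
  have hρ : 1 ≤ √(d₂ : ℝ) := Real.one_le_sqrt.2 (by exact_mod_cast hd₂)
  have hS := sampleSize_pos hm hT
  have hM := h.momentScale_pos (zero_lt_one.trans_le hρ)
  have htail := measureReal_le_norm_sub_integral_le_of_iIndepFun (μ := μ)
    (X := fun p : Fin m × ℕ => ξ p.1 p.2) (fun p => hξ.measurable p.1 p.2) hξ.indep
    (S := fun _ => {v | ‖WithLp.toLp 2 v‖ ≤ √d₂})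
    (fun _ => measurableSet_le ((PiLp.continuous_toLp 2 _).norm.measurable) measurable_const)
    (fun p => hξ.norm_le p.1 p.2)
    (continuous_entries_meanMoment A B K w q Tc l).stronglyMeasurable
    (dependsOn_entries_meanMoment A B K w hl)
    (fun p _ z hz v hv => h.norm_entries_meanMoment_sub_le hρ hz
      (fun p' => Function.forall_update_iff z (fun _ v => ‖WithLp.toLp 2 v‖ ≤ √d₂) |>.2
        ⟨hv, fun x _ => hz x⟩ p')
      (fun p' hp' => Function.update_of_ne hp' v z) hm hT l)
    (by positivity)
    (sum_inv_sampleSize_mul_momentVariation_sq_le h.rate_pos h.rate_le_one _ hm hT l) hr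
  rwa [hξ.integral_entries_meanMoment A B K w hm hT l] at htail

end ClosedLoopBounds

end Concentration

section Identification

variable {m d₁ d₂ q Tc Te : ℕ} {A : Matrix (Fin d₁) (Fin d₁) ℝ} {B : Matrix (Fin d₁) (Fin d₂) ℝ}
  {K : Matrix (Fin d₂) (Fin d₁) ℝ} {P : Matrix (Fin m) (Fin m) ℝ} {w : ℕ → Fin d₁ → ℝ}
  {κ γ W δ ρ : ℝ}

theorem ofReal_one_sub_le_measure {Ω : Type*} [MeasurableSpace Ω] {μ : Measure Ω}
    [IsProbabilityMeasure μ] {s : Set Ω} (h : μ.real sᶜ ≤ δ) : ENNReal.ofReal (1 - δ) ≤ μ s := by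
  rw [ENNReal.ofReal_sub _ (measureReal_nonneg.trans h), ENNReal.ofReal_one, tsub_le_iff_right]
  calc 1 = μ Set.univ := measure_univ.symm
    _ ≤ μ s + μ sᶜ := measure_univ_le_add_compl s
    _ ≤ μ s + ENNReal.ofReal δ := by
      gcongr
      exact (ofReal_measureReal (measure_ne_top μ _)).symm.trans_le (ENNReal.ofReal_le_ofReal h)

theorem exp_neg_logFactor_le (hm : 0 < m) (hd₁ : 0 < d₁) (hd₂ : 0 < d₂) (hδ : 0 < δ) :
    Real.exp (-logFactor m d₁ d₂ q δ) ≤ δ / ((q : ℝ) + 1) := by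
  have hm1 : (1 : ℝ) ≤ m := by exact_mod_cast hm
  have hd₁1 : (1 : ℝ) ≤ d₁ := by exact_mod_cast hd₁
  have hd₂1 : (1 : ℝ) ≤ d₂ := by exact_mod_cast hd₂
  have hq : (0 : ℝ) < (q : ℝ) + 1 := by positivity
  rw [logFactor, ← Real.log_inv, Real.exp_log (by positivity), inv_div]
  refine div_le_div_of_nonneg_left hδ.le hq ?_
  calc (q : ℝ) + 1 = 1 * 1 * ((q : ℝ) + 1) * 1 := by ring
    _ ≤ d₁ * d₂ * ((q : ℝ) + 1) * m := by gcongr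

theorem logFactor_pos (hm : 0 < m) (hd₁ : 0 < d₁) (hd₂ : 0 < d₂) (hδ : 0 < δ) (hδ1 : δ < 1) :
    0 < logFactor m d₁ d₂ q δ := by
  have hlt : δ / ((q : ℝ) + 1) < 1 :=
    (div_le_self hδ.le (le_add_of_nonneg_left q.cast_nonneg)).trans_lt hδ1
  exact neg_lt_zero.1 (Real.exp_lt_one_iff.1 ((exp_neg_logFactor_le hm hd₁ hd₂ hδ).trans_lt hlt))

theorem add_one_mul_two_mul_exp_neg_two_mul_logFactor_le (hm : 0 < m) (hd₁ : 0 < d₁) (hd₂ : 0 < d₂)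
    (hδ : 0 < δ) (hδ1 : δ < 1) (hq : 1 ≤ q) :
    ((q : ℝ) + 1) * (2 * Real.exp (-(2 * logFactor m d₁ d₂ q δ))) ≤ δ := by
  have hq1 : (1 : ℝ) ≤ q := by exact_mod_cast hq
  have hexp : Real.exp (-(2 * logFactor m d₁ d₂ q δ)) ≤ (δ / ((q : ℝ) + 1)) ^ 2 := by
    rw [← mul_neg, two_mul, Real.exp_add, ← sq]
    exact pow_le_pow_left₀ (Real.exp_pos _).le (exp_neg_logFactor_le hm hd₁ hd₂ hδ) 2
  calc _ ≤ ((q : ℝ) + 1) * (2 * (δ / ((q : ℝ) + 1)) ^ 2) := by gcongr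
    _ = δ * (δ * 2 / ((q : ℝ) + 1)) := by field_simp
    _ ≤ δ * 1 := by
        gcongr
        rw [div_le_one (by positivity)]
        linarith
    _ = δ := mul_one δ

theorem StronglyStable.closedLoopBounds (h : StronglyStable A B K κ γ) (hκ : 1 ≤ κ) (hW : 1 ≤ W)
    (hB : ‖B‖ ≤ κ) (hw : ∀ t, ‖WithLp.toLp 2 (w t)‖ ≤ W) : ClosedLoopBounds A B K w κ γ W :=
  ⟨hκ, h.2.1, h.2.2.1, hW, h.norm_pow_le, hB, hw⟩

/-- The accuracy of the agents' moments that holds with high probability. It is the sum of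
`13 M √(Λ / S)` for the deviation of the network average from its mean and `3 M √(Λ / S)` for the
disagreement between the agents, where `M` is the scale of the moments. -/
noncomputable def momentError (m d₁ d₂ q Tc : ℕ) (κ γ W δ : ℝ) : ℝ :=
  16 * momentScale κ γ W √d₂ * √(logFactor m d₁ d₂ q δ / sampleSize m q Tc)

namespace ClosedLoopBounds

theorem norm_entries_finalMoment_sub_le (h : ClosedLoopBounds A B K w κ γ W) (hρ : 1 ≤ ρ)
    {ξ : Fin m → ℕ → Fin d₂ → ℝ} (hξ : ∀ i t, ‖WithLp.toLp 2 (ξ i t)‖ ≤ ρ) (hT : q + 1 < Tc)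
    (hP : P ∈ doublyStochastic ℝ (Fin m)) (i : Fin m) (l : ℕ) :
    ‖entries (finalMoment A B K P q Tc Te w ξ i l) - entries (meanMoment A B K w q Tc ξ l)‖ ≤
      √m * secondSingularValue P ^ Te * (2 * momentScale κ γ W ρ) := by
  rw [← map_sub]
  exact norm_exchange_sub_mean_le hP
    (fun j => h.norm_entries_localMoment_le hρ (hξ j) hT l) Te i

variable {Ω : Type*} [MeasurableSpace Ω] {μ : Measure Ω} [IsProbabilityMeasure μ]
  {ξ : Fin m → ℕ → Ω → Fin d₂ → ℝ}

theorem measureReal_exists_le_norm_entries_meanMoment_sub_le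
    (h : ClosedLoopBounds A B K w κ γ W) (hξ : IsIsotropicNoise μ ξ) (hm : 0 < m) (hd₁ : 0 < d₁)
    (hd₂ : 0 < d₂) (hδ : 0 < δ) (hδ1 : δ < 1) (hq : 1 ≤ q) (hT : q + 1 < Tc) :
    μ.real {ω | ∃ l ≤ q,
      13 * momentScale κ γ W √d₂ * √(logFactor m d₁ d₂ q δ / sampleSize m q Tc) ≤
        ‖entries (meanMoment A B K w q Tc (fun i t => ξ i t ω) l) -
          entries ((A - B * K) ^ l * B)‖} ≤ δ := by
  have hΛ := logFactor_pos (q := q) hm hd₁ hd₂ hδ hδ1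
  have hS := sampleSize_pos hm hT
  have hM := h.momentScale_pos (Real.sqrt_pos.2 (Nat.cast_pos.2 hd₂))
  have hδq := add_one_mul_two_mul_exp_neg_two_mul_logFactor_le hm hd₁ hd₂ hδ hδ1 hq
  set M := momentScale κ γ W √d₂
  set Λ := logFactor m d₁ d₂ q δ
  set S := sampleSize m q Tc
  have hexponent : 2 * Λ ≤ (13 * M * √(Λ / S)) ^ 2 / (2 * (40 * M ^ 2 / S)) := by
    rw [mul_pow, Real.sq_sqrt (by positivity)]
    calc 2 * Λ ≤ 169 / 80 * Λ := by linarith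
      _ = _ := by field_simp; norm_num
  have htail : ∀ l ∈ Finset.range (q + 1), μ.real {ω | 13 * M * √(Λ / S) ≤
      ‖entries (meanMoment A B K w q Tc (fun i t => ξ i t ω) l) -
        entries ((A - B * K) ^ l * B)‖} ≤ 2 * Real.exp (-(2 * Λ)) := fun l hl =>
    (h.measureReal_le_norm_entries_meanMoment_sub_le hξ hm hd₂ hT
      (Finset.mem_range_succ_iff.1 hl) (by positivity)).trans (by gcongr)
  calc _ = μ.real (⋃ l ∈ Finset.range (q + 1), {ω | 13 * M * √(Λ / S) ≤
        ‖entries (meanMoment A B K w q Tc (fun i t => ξ i t ω) l) -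
          entries ((A - B * K) ^ l * B)‖}) := by
        congr 1
        ext ω
        simp only [Set.mem_ofPred_eq, Set.mem_iUnion, Finset.mem_range_succ_iff, exists_prop]
    _ ≤ ∑ l ∈ Finset.range (q + 1), 2 * Real.exp (-(2 * Λ)) :=
        (measureReal_biUnion_finset_le _ _).trans (Finset.sum_le_sum htail)
    _ = ((q : ℝ) + 1) * (2 * Real.exp (-(2 * Λ))) := by
        rw [Finset.sum_const, Finset.card_range, nsmul_eq_mul, Nat.cast_add, Nat.cast_one]
    _ ≤ δ := hδq

theorem norm_entries_finalMoment_sub_le_momentError (h : ClosedLoopBounds A B K w κ γ W)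
    {ξ : Fin m → ℕ → Fin d₂ → ℝ} (hξ : ∀ i t, ‖WithLp.toLp 2 (ξ i t)‖ ≤ √d₂) (hd₂ : 0 < d₂)
    (hT : q + 1 < Tc) (hP : P ∈ doublyStochastic ℝ (Fin m))
    (hTe : √m * secondSingularValue P ^ Te ≤ √(2 * logFactor m d₁ d₂ q δ / sampleSize m q Tc))
    {l : ℕ} (hmean : ‖entries (meanMoment A B K w q Tc ξ l) - entries ((A - B * K) ^ l * B)‖ ≤
      13 * momentScale κ γ W √d₂ * √(logFactor m d₁ d₂ q δ / sampleSize m q Tc)) (i : Fin m) :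
    ‖entries (finalMoment A B K P q Tc Te w ξ i l - (A - B * K) ^ l * B)‖ ≤
      momentError m d₁ d₂ q Tc κ γ W δ := by
  have hρ : 1 ≤ √(d₂ : ℝ) := Real.one_le_sqrt.2 (by exact_mod_cast hd₂)
  have hM := h.momentScale_pos (zero_lt_one.trans_le hρ)
  have hsqrt2 : √2 ≤ 3 / 2 := Real.sqrt_le_iff.2 ⟨by norm_num, by norm_num⟩
  have hagree := h.norm_entries_finalMoment_sub_le (Te := Te) hρ hξ hT hP i l
  rw [mul_div_assoc, Real.sqrt_mul zero_le_two] at hTe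
  rw [map_sub, momentError]
  set M := momentScale κ γ W √d₂
  set s := √(logFactor m d₁ d₂ q δ / sampleSize m q Tc)
  calc _ ≤ √m * secondSingularValue P ^ Te * (2 * M) + 13 * M * s :=
        (norm_sub_le_norm_sub_add_norm_sub _ _ _).trans (add_le_add hagree hmean)
    _ ≤ 3 / 2 * s * (2 * M) + 13 * M * s := by
        have hdisagree : √m * secondSingularValue P ^ Te ≤ 3 / 2 * s := hTe.trans (by gcongr)
        gcongr
    _ = 16 * M * s := by ring

theorem ofReal_one_sub_le_measure_norm_entries_finalMoment_sub_le
    (h : ClosedLoopBounds A B K w κ γ W) (hξ : IsIsotropicNoise μ ξ) (hm : 0 < m) (hd₁ : 0 < d₁)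
    (hd₂ : 0 < d₂) (hδ : 0 < δ) (hδ1 : δ < 1) (hq : 1 ≤ q) (hT : q + 1 < Tc)
    (hP : P ∈ doublyStochastic ℝ (Fin m))
    (hTe : √m * secondSingularValue P ^ Te ≤ √(2 * logFactor m d₁ d₂ q δ / sampleSize m q Tc)) :
    ENNReal.ofReal (1 - δ) ≤ μ {ω | ∀ i, ∀ l ≤ q,
      ‖entries (finalMoment A B K P q Tc Te w (fun j t => ξ j t ω) i l - (A - B * K) ^ l * B)‖ ≤
        momentError m d₁ d₂ q Tc κ γ W δ} := by
  have hbad :=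
    h.measureReal_exists_le_norm_entries_meanMoment_sub_le hξ hm hd₁ hd₂ hδ hδ1 hq hT
  rw [← compl_compl {ω | ∃ l ≤ q, _}] at hbad
  refine (ofReal_one_sub_le_measure hbad).trans (measure_mono_ae ?_)
  filter_upwards [ae_all_iff.2 fun i => ae_all_iff.2 (hξ.norm_le i)] with ω hω hgood i l hl
  refine h.norm_entries_finalMoment_sub_le_momentError hω hd₂ hT hP hTe ?_ i
  exact (not_le.1 fun hle => hgood ⟨l, hl, hle⟩).le

end ClosedLoopBounds

theorem momentScale_sqrt (κ γ W : ℝ) (d : ℕ) : momentScale κ γ W √d = κ ^ 3 * d * W / γ := by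
  rw [momentScale, Real.sq_sqrt d.cast_nonneg]

theorem sqrt_mul_momentError_le (hκ : 0 < κ) (hγ : 0 < γ) (hΛ : 0 ≤ logFactor m d₁ d₂ q δ)
    (hS0 : 0 < sampleSize m q Tc)
    (hS : 1024 * ((q : ℝ) * (d₂ : ℝ) ^ 2 * κ ^ 7 * W ^ 2 / γ ^ 2) * logFactor m d₁ d₂ q δ ≤
      sampleSize m q Tc) :
    √q * momentError m d₁ d₂ q Tc κ γ W δ ≤ 1 / (2 * √κ) := by
  rw [le_div_iff₀ (by positivity)]
  refine le_of_sq_le_sq ?_ zero_le_one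
  rw [momentError, momentScale_sqrt]
  simp only [mul_pow]
  rw [Real.sq_sqrt q.cast_nonneg, Real.sq_sqrt (div_nonneg hΛ hS0.le), Real.sq_sqrt hκ.le, one_pow]
  calc _ = 1024 * ((q : ℝ) * (d₂ : ℝ) ^ 2 * κ ^ 7 * W ^ 2 / γ ^ 2) * logFactor m d₁ d₂ q δ /
        sampleSize m q Tc := by
        field_simp
        ring
    _ ≤ 1 := (div_le_one hS0).2 hS

theorem momentError_nonneg (hκ : 0 ≤ κ) (hγ : 0 ≤ γ) (hW : 0 ≤ W) :
    0 ≤ momentError m d₁ d₂ q Tc κ γ W δ := by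
  rw [momentError, momentScale]
  positivity

theorem sqrt_mul_sq_mul_sqrt_mul_momentError_le (hκ : 0 < κ) (hγ : 0 < γ) (hW : 0 ≤ W)
    (hd₁ : 0 < d₁) :
    √κ * κ ^ 2 * (√q * momentError m d₁ d₂ q Tc κ γ W δ) ≤
      16 * estimationRate m d₁ d₂ q Tc κ γ W δ := by
  have hd₁1 : (1 : ℝ) ≤ d₁ := by exact_mod_cast hd₁
  have hpow : κ ^ (11 / 2 : ℝ) = κ ^ 5 * √κ := by
    rw [Real.sqrt_eq_rpow, ← Real.rpow_natCast, ← Real.rpow_add hκ]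
    norm_num
  rw [momentError, momentScale_sqrt, estimationRate, hpow]
  set s := √(logFactor m d₁ d₂ q δ / sampleSize m q Tc)
  calc _ = 16 * (d₂ * W * √q * (κ ^ 5 * √κ) / γ * s) := by ring
    _ ≤ 16 * (d₂ * W * √(d₁ * q) * (κ ^ 5 * √κ) / γ * s) := by
        gcongr
        exact le_mul_of_one_le_left q.cast_nonneg hd₁1

theorem momentError_le (hκ : 1 ≤ κ) (hγ : 0 < γ) (hW : 0 ≤ W) (hd₁ : 0 < d₁) (hq : 1 ≤ q) :
    momentError m d₁ d₂ q Tc κ γ W δ ≤ 16 * estimationRate m d₁ d₂ q Tc κ γ W δ := by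
  have hκ0 := zero_lt_one.trans_le hκ
  have hfactor : 1 ≤ √κ * κ ^ 2 :=
    one_le_mul_of_one_le_of_one_le (Real.one_le_sqrt.2 hκ) (one_le_pow₀ hκ)
  have hsq : 1 ≤ √(q : ℝ) := Real.one_le_sqrt.2 (by exact_mod_cast hq)
  have hε := momentError_nonneg (m := m) (d₁ := d₁) (d₂ := d₂) (q := q) (Tc := Tc) (δ := δ)
    hκ0.le hγ.le hW
  calc _ = 1 * (1 * momentError m d₁ d₂ q Tc κ γ W δ) := by rw [one_mul, one_mul]
    _ ≤ √κ * κ ^ 2 * (√q * momentError m d₁ d₂ q Tc κ γ W δ) := by gcongr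
    _ ≤ _ := sqrt_mul_sq_mul_sqrt_mul_momentError_le hκ0 hγ hW hd₁

theorem estimationRate_nonneg (hκ : 0 ≤ κ) (hγ : 0 ≤ γ) (hW : 0 ≤ W) :
    0 ≤ estimationRate m d₁ d₂ q Tc κ γ W δ := by
  rw [estimationRate]
  positivity

end Identification

end DistributedSysId

open DistributedSysId in
theorem mainTheorem3_general :
    ∃ C : ℝ, 0 < C ∧
      ∀ (m d₁ d₂ q Tc Te : ℕ) (κ γ W δ : ℝ)
        (A : Matrix (Fin d₁) (Fin d₁) ℝ) (B : Matrix (Fin d₁) (Fin d₂) ℝ)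
        (K : Matrix (Fin d₂) (Fin d₁) ℝ) (P : Matrix (Fin m) (Fin m) ℝ)
        (w : ℕ → Fin d₁ → ℝ)
        (Ω : Type*) [MeasurableSpace Ω] (μ : Measure Ω) [IsProbabilityMeasure μ]
        (ξ : Fin m → ℕ → Ω → (Fin d₂ → ℝ)),
        0 < m → 0 < d₁ → 0 < d₂ →
        1 ≤ κ → 1 ≤ W → 0 < δ → δ < 1 →
        ‖B‖ ≤ κ → (∀ t, ‖WithLp.toLp 2 (w t)‖ ≤ W) →
        StronglyStable A B K κ γ →
        StronglyControllable (A - B * K) B q κ →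
        P ∈ doublyStochastic ℝ (Fin m) →
        IsIsotropicNoise μ ξ →
        q + 1 < Tc →
        C * ((q : ℝ) * (d₂ : ℝ) ^ 2 * κ ^ 7 * W ^ 2 / γ ^ 2) *
          logFactor m d₁ d₂ q δ ≤ sampleSize m q Tc →
        √m * secondSingularValue P ^ Te ≤ √(2 * logFactor m d₁ d₂ q δ / sampleSize m q Tc) →
        ENNReal.ofReal (1 - δ) ≤ μ {ω | ∀ i : Fin m,
          let N : ℕ → Matrix (Fin d₁) (Fin d₂) ℝ :=
            finalMoment A B K P q Tc Te w (fun j t => ξ j t ω) i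
          IsUnit (regressor q N * (regressor q N)ᵀ) ∧
          ‖estimateA q K N - A‖ ≤
            C * estimationRate m d₁ d₂ q Tc κ γ W δ ∧
          ‖estimateB N - B‖ ≤
            C * estimationRate m d₁ d₂ q Tc κ γ W δ} := by
  refine ⟨1024, by norm_num, ?_⟩
  intro m d₁ d₂ q Tc Te κ γ W δ A B K P w Ω _ μ _ ξ hm hd₁ hd₂ hκ hW hδ hδ1 hB hw hst hco hP hξ
    hT hS hTe
  have hκ0 : 0 < κ := zero_lt_one.trans_le hκ
  have hW0 : 0 ≤ W := zero_le_one.trans hW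
  have hγ : 0 < γ := hst.2.1
  have hrate : 0 ≤ estimationRate m d₁ d₂ q Tc κ γ W δ := estimationRate_nonneg hκ0.le hγ.le hW0
  have hsmall : √q * momentError m d₁ d₂ q Tc κ γ W δ ≤ 1 / (2 * √κ) :=
    sqrt_mul_momentError_le hκ0 hγ (logFactor_pos hm hd₁ hd₂ hδ hδ1).le (sampleSize_pos hm hT) hS
  have hrateA := sqrt_mul_sq_mul_sqrt_mul_momentError_le (m := m) (d₂ := d₂) (q := q) (Tc := Tc)
    (δ := δ) hκ0 hγ hW0 hd₁
  have hrateB := momentError_le (m := m) (d₂ := d₂) (Tc := Tc) (δ := δ) hκ hγ hW0 hd₁ hco.1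
  have hmoments := (hst.closedLoopBounds hκ hW hB hw
    ).ofReal_one_sub_le_measure_norm_entries_finalMoment_sub_le hξ hm hd₁ hd₂ hδ hδ1 hco.1 hT hP hTe
  refine hmoments.trans (measure_mono fun ω hω i => ?_)
  obtain ⟨hunit, hest⟩ := isUnit_and_norm_estimateA_sub_le hκ hst hco (hω i) hsmall
  have hestB := norm_estimateB_sub_le (hω i 0 q.zero_le)
  exact ⟨hunit, by linarith, by linarith⟩

theorem mainTheorem3 :
    ∃ C : ℝ, 0 < C ∧
      ∀ (m d₁ d₂ q Tc Te : ℕ) (κ γ W δ : ℝ)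
        (A : Matrix (Fin d₁) (Fin d₁) ℝ) (B : Matrix (Fin d₁) (Fin d₂) ℝ)
        (K : Matrix (Fin d₂) (Fin d₁) ℝ) (P : Matrix (Fin m) (Fin m) ℝ)
        (w : ℕ → Fin d₁ → ℝ)
        (Ω : Type*) [MeasurableSpace Ω] (μ : Measure Ω) [IsProbabilityMeasure μ]
        (ξ : Fin m → ℕ → Ω → (Fin d₂ → ℝ)),
        0 < m → 0 < d₁ → 0 < d₂ →
        1 ≤ κ → 1 ≤ W → 0 < δ → δ < 1 →
        ‖A‖ ≤ κ → ‖B‖ ≤ κ → (∀ t, ‖WithLp.toLp 2 (w t)‖ ≤ W) →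
        DistributedSysId.StronglyStable A B K κ γ →
        DistributedSysId.StronglyControllable (A - B * K) B q κ →
        DistributedSysId.IsNetworkMatrix P →
        DistributedSysId.IsExplorationNoise μ ξ →
        q + 1 < Tc →
        C * ((q : ℝ) * (d₂ : ℝ) ^ 2 * κ ^ 7 * W ^ 2 / γ ^ 2) *
            DistributedSysId.logFactor m d₁ d₂ q δ ≤ DistributedSysId.sampleSize m q Tc →
        Real.sqrt m * DistributedSysId.secondSingularValue P ^ Te ≤
          Real.sqrt (2 * DistributedSysId.logFactor m d₁ d₂ q δ /
            DistributedSysId.sampleSize m q Tc) →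
        ENNReal.ofReal (1 - δ) ≤ μ {ω | ∀ i : Fin m,
          let N : ℕ → Matrix (Fin d₁) (Fin d₂) ℝ :=
            DistributedSysId.finalMoment A B K P q Tc Te w (fun j t => ξ j t ω) i
          IsUnit (DistributedSysId.regressor q N * (DistributedSysId.regressor q N)ᵀ) ∧
          ‖DistributedSysId.estimateA q K N - A‖ ≤
            C * DistributedSysId.estimationRate m d₁ d₂ q Tc κ γ W δ ∧
          ‖DistributedSysId.estimateB N - B‖ ≤
            C * DistributedSysId.estimationRate m d₁ d₂ q Tc κ γ W δ} := by
  obtain ⟨C, hC, h⟩ := mainTheorem3_general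
  exact ⟨C, hC, fun m d₁ d₂ q Tc Te κ γ W δ A B K P w Ω _ μ _ ξ hm hd₁ hd₂ hκ hW hδ hδ1 _ hB hw hst
    hco hP hξ => h m d₁ d₂ q Tc Te κ γ W δ A B K P w Ω μ ξ hm hd₁ hd₂ hκ hW hδ hδ1 hB hw hst hco
      hP.doublyStochastic hξ.isIsotropicNoise⟩
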